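/- **Theorem 8.1.** Let $n\ge 2$, $c_1,\dots,c_n>0$ and $0\le a_1\le\dots\le a_n$ be real numbers, let $N_1,\dots,N_n$ be copies of $(0,\infty)$ with their endpoints $0$ identified (a star), and let $H=\prod_{k=1}^n L^2(N_k)$ (complex valued). Let $A$ be the operator on $H$ with $$A(u_k)_{k}=(-c_k\,\partial_x^2u_k+a_ku_k)_{k},\qquad D(A)=\Big\{u\in\prod_{k=1}^nH^2(N_k)\ :\ u \text{ satisfies }(T_0),(T_1)\Big\},$$ where $(T_0)$: every $u_k$ is continuous on $[0,\infty)$, and $u_i(0)=u_k(0)$ for all $i,k$; $(T_1)$: every $u_k$ is $C^1$ on $[0,\infty)$, and $\sum_{k=1}^n c_k\,\partial_xu_k(0^+)=0$. For $\lambda$ in the resolvent set $\rho(A)$, a function $\mathcal K:(0,\infty)\times(0,\infty)\to\mathbb C^{n\times n}$ is called a kernel of the resolvent $R(\lambda,A)=(\lambda I-A)^{-1}$ if for all $f\in H$ and all $i$, for almost every $x>0$, $$(R(\lambda,A)f)_i(x)=\sum_{j=1}^n\int_0^\infty\mathcal K_{ij}(x,x')f_j(x')\,dx',$$ all integrals being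 absolutely convergent. Let $\ker(A_T-\lambda I)$ be the space of generalized eigenfunctions satisfying the transmission conditions, i.e. of all $w=(w_1,\dots,w_n)$ with $w_k\in C^2((0,\infty))$ which satisfy $(T_0)$, $(T_1)$ and $-c_kw_k''+a_kw_k=\lambda w_k$ on $(0,\infty)$ for every $k$ (without conditions at infinity). Then for every $\lambda\in\rho(A)$: 1. The following explicit function $K(\cdot,\cdot,\lambda)$ is a kernel of $R(\lambda,A)$. Put $\sqrt{re^{i\phi}}=\sqrt r\,e^{i\phi/2}$ for $r\ge0$, $\phi\in[-\pi,\pi)$, and $\xi_k=\sqrt{(\lambda-a_k)/c_k}$, $s_j=-\big(\sum_{l\ne j}c_l\xi_l\big)/(c_j\xi_j)$; let the sign $\pm$ be $+$ if $\operatorname{Im}\lambda>0$ and $-$ if $\operatorname{Im}\lambda\le0$, and put $W=\pm i\sum_jc_j\xi_j$. Let $F^{j}_j(x)=\cos(\xi_jx)\pm i s_j\sin(\xi_jx)$ and $F^{j}_k(x)=e^{\pm i\xi_kx}$ for $k\ne j$ ($F^j_k$ is the component on $N_k$ of $F^j$). Then, with $j+1$ taken modulo $n$, $$K_{jj}(x,x',\lambda)=\tfrac1W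 F^j_j(x)F^{j+1}_j(x')\ \text{ for } x'>x,\qquad K_{jk}(x,x',\lambda)=\tfrac1W F^{j+1}_j(x)F^{j}_k(x')\ \text{ for } k\neq j\text{, or } k=j,\ x'\le x.$$ 2. No kernel $\mathcal K$ of $R(\lambda,A)$ (in particular not $K(\cdot,\cdot,\lambda)$) can be written in Weidmann's form using exclusively generalized eigenfunctions satisfying $(T_0)$ and $(T_1)$: there are no $p\in\mathbb N$, coefficients $\alpha_{lq},\beta_{lq}\in\mathbb C$ and functions $w_1,\dots,w_p\in\ker(A_T-\lambda I)$ such that for all $x,x'>0$ $$\mathcal K(x,x')=\begin{cases}\displaystyle\sum_{q=1}^p\Big(\sum_{l=1}^p\alpha_{lq}\,w_l(x)\Big)w_q(x')^T,& x'\le x,\\[2ex]\displaystyle\sum_{q=1}^p\Big(\sum_{l=1}^p\beta_{lq}\,w_l(x)\Big)w_q(x')^T,& x'>x.\end{cases}$$ -/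

import Mathlib

open MeasureTheory Set

open scoped ContDiff

noncomputable section

/-- `L²((0, ∞))`, complex valued: the functions on one open branch of the star. -/
abbrev HalfL2 : Type := Lp ℂ 2 (volume.restrict (Ioi (0 : ℝ)))

/-- The Hilbert space `H = ∏_{k} L²(N_k)`, every branch `N_k` being a copy of `(0, ∞)`. -/
abbrev StarL2 (n : ℕ) : Type := PiLp 2 (fun _ : Fin n => HalfL2)

/-- `g` is the weak derivative of `f` on `(0, ∞)`. -/
def HasWeakDeriv (f g : HalfL2) : Prop :=
  ∀ φ : ℝ → ℝ, ContDiff ℝ ∞ φ → HasCompactSupport φ → tsupport φ ⊆ Ioi 0 →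
    ∫ x in Ioi (0 : ℝ), deriv φ x • f x = - ∫ x in Ioi (0 : ℝ), φ x • g x

/-- `f ∈ H²((0, ∞))` with weak second derivative `h`. -/
def HasWeakDeriv2 (f h : HalfL2) : Prop :=
  ∃ g : HalfL2, HasWeakDeriv f g ∧ HasWeakDeriv g h

/-- Membership in the Sobolev space `H²((0, ∞))`. -/
def MemH2 (f : HalfL2) : Prop := ∃ h : HalfL2, HasWeakDeriv2 f h

open Classical in
/-- The weak second derivative of an element of `H²((0, ∞))` (zero outside `H²`). -/
def weakDeriv2 (f : HalfL2) : HalfL2 :=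
  if hf : MemH2 f then hf.choose else 0

/-- The transmission condition `(T₀)`: continuity on the closed branches and at the node. -/
def TransmissionT0 {n : ℕ} (U : Fin n → ℝ → ℂ) : Prop :=
  (∀ k, ContinuousOn (U k) (Ici 0)) ∧ ∀ i k, U i 0 = U k 0

/-- The transmission condition `(T₁)`: `C¹` on the closed branches, and the Kirchhoff condition
`∑ c_k ∂_x u_k(0⁺) = 0` at the node. -/
def TransmissionT1 {n : ℕ} (c : Fin n → ℝ) (U : Fin n → ℝ → ℂ) : Prop :=
  (∀ k, ContDiffOn ℝ 1 (U k) (Ici 0)) ∧ ∑ k, (c k : ℂ) * derivWithin (U k) (Ici 0) 0 = 0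

theorem integrable_smul_half (f : HalfL2) (φ : ℝ → ℝ) (hφ : Continuous φ)
    (hc : HasCompactSupport φ) :
    Integrable (fun x => φ x • f x) (volume.restrict (Ioi (0 : ℝ))) := by
  have h1 : LocallyIntegrable (fun x => f x) (volume.restrict (Ioi (0 : ℝ))) :=
    (Lp.memLp f).locallyIntegrable (by norm_num)
  exact h1.integrable_smul_left_of_hasCompactSupport hφ hc

theorem HasWeakDeriv.add {f g f' g' : HalfL2} (h : HasWeakDeriv f g) (h' : HasWeakDeriv f' g') :
    HasWeakDeriv (f + f') (g + g') := by
  intro φ h1 h2 h3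
  have hd : Continuous (deriv φ) := h1.continuous_deriv (by simp)
  have e1 : ∫ x in Ioi (0 : ℝ), deriv φ x • (f + f') x =
      ∫ x in Ioi (0 : ℝ), (deriv φ x • f x + deriv φ x • f' x) := by
    refine integral_congr_ae ?_
    filter_upwards [Lp.coeFn_add f f'] with x hx
    rw [hx, Pi.add_apply, smul_add]
  have e2 : ∫ x in Ioi (0 : ℝ), φ x • (g + g') x =
      ∫ x in Ioi (0 : ℝ), (φ x • g x + φ x • g' x) := by
    refine integral_congr_ae ?_
    filter_upwards [Lp.coeFn_add g g'] with x hx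
    rw [hx, Pi.add_apply, smul_add]
  rw [e1, e2, integral_add (integrable_smul_half _ _ hd h2.deriv)
    (integrable_smul_half _ _ hd h2.deriv), integral_add
    (integrable_smul_half _ _ h1.continuous h2) (integrable_smul_half _ _ h1.continuous h2),
    h φ h1 h2 h3, h' φ h1 h2 h3, neg_add]

theorem HasWeakDeriv.smul {f g : HalfL2} (z : ℂ) (h : HasWeakDeriv f g) :
    HasWeakDeriv (z • f) (z • g) := by
  intro φ h1 h2 h3
  have e1 : ∫ x in Ioi (0 : ℝ), deriv φ x • (z • f) x =
      ∫ x in Ioi (0 : ℝ), z • (deriv φ x • f x) := by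
    refine integral_congr_ae ?_
    filter_upwards [Lp.coeFn_smul z f] with x hx
    rw [hx, Pi.smul_apply, smul_comm]
  have e2 : ∫ x in Ioi (0 : ℝ), φ x • (z • g) x =
      ∫ x in Ioi (0 : ℝ), z • (φ x • g x) := by
    refine integral_congr_ae ?_
    filter_upwards [Lp.coeFn_smul z g] with x hx
    rw [hx, Pi.smul_apply, smul_comm]
  rw [e1, e2, integral_smul, integral_smul, h φ h1 h2 h3, smul_neg]

theorem HasWeakDeriv.zero : HasWeakDeriv 0 0 := by
  intro φ _ _ _
  have e : ∀ ψ : ℝ → ℝ, ∫ x in Ioi (0 : ℝ), ψ x • (0 : HalfL2) x = 0 := by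
    intro ψ
    rw [← integral_zero ℝ ℂ (μ := volume.restrict (Ioi (0 : ℝ)))]
    refine integral_congr_ae ?_
    filter_upwards [Lp.coeFn_zero ℂ 2 (volume.restrict (Ioi (0 : ℝ)))] with x hx
    rw [hx, Pi.zero_apply, smul_zero]
  rw [e, e, neg_zero]

theorem HasWeakDeriv.unique {f g g' : HalfL2} (h : HasWeakDeriv f g) (h' : HasWeakDeriv f g') :
    g = g' := by
  have hk : HasWeakDeriv 0 (g - g') := by
    have := h.add (h'.smul (-1))
    simpa [sub_eq_add_neg] using this
  have hz : ∀ᵐ x ∂(volume.restrict (Ioi (0 : ℝ))), x ∈ Ioi (0 : ℝ) → (g - g' : HalfL2) x = 0 := by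
    refine isOpen_Ioi.ae_eq_zero_of_integral_contDiff_smul_eq_zero ?_ ?_
    · exact ((Lp.memLp (g - g')).locallyIntegrable (by norm_num)).locallyIntegrableOn _
    · intro φ h1 h2 h3
      have e1 := hk φ h1 h2 h3
      have e2 : ∫ x in Ioi (0 : ℝ), deriv φ x • (0 : HalfL2) x = 0 := by
        rw [← integral_zero ℝ ℂ (μ := volume.restrict (Ioi (0 : ℝ)))]
        refine integral_congr_ae ?_
        filter_upwards [Lp.coeFn_zero ℂ 2 (volume.restrict (Ioi (0 : ℝ)))] with x hx
        rw [hx, Pi.zero_apply, smul_zero]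
      rw [e2] at e1
      exact neg_eq_zero.1 e1.symm
  have : (g - g' : HalfL2) = 0 := by
    rw [Lp.eq_zero_iff_ae_eq_zero]
    filter_upwards [hz, ae_restrict_mem measurableSet_Ioi] with x hx hx'
    exact hx hx'
  exact sub_eq_zero.1 this

theorem HasWeakDeriv2.weakDeriv2_eq {f h : HalfL2} (hf : HasWeakDeriv2 f h) :
    weakDeriv2 f = h := by
  have hm : MemH2 f := ⟨h, hf⟩
  have hw : weakDeriv2 f = hm.choose := by
    unfold weakDeriv2
    rw [dif_pos hm]
  rw [hw]
  obtain ⟨g, h1, h2⟩ := hf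
  obtain ⟨g', h1', h2'⟩ := hm.choose_spec
  have hg : g' = g := h1'.unique h1
  subst hg
  exact h2'.unique h2

theorem MemH2.hasWeakDeriv2 {f : HalfL2} (hf : MemH2 f) : HasWeakDeriv2 f (weakDeriv2 f) := by
  obtain ⟨h, hh⟩ := hf
  rw [hh.weakDeriv2_eq]
  exact hh

theorem HasWeakDeriv2.add {f h f' h' : HalfL2} (H : HasWeakDeriv2 f h)
    (H' : HasWeakDeriv2 f' h') : HasWeakDeriv2 (f + f') (h + h') := by
  obtain ⟨g, h1, h2⟩ := H
  obtain ⟨g', h1', h2'⟩ := H'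
  exact ⟨g + g', h1.add h1', h2.add h2'⟩

theorem HasWeakDeriv2.smul {f h : HalfL2} (z : ℂ) (H : HasWeakDeriv2 f h) :
    HasWeakDeriv2 (z • f) (z • h) := by
  obtain ⟨g, h1, h2⟩ := H
  exact ⟨z • g, h1.smul z, h2.smul z⟩

theorem TransmissionT0.add {n : ℕ} {U V : Fin n → ℝ → ℂ} (hU : TransmissionT0 U)
    (hV : TransmissionT0 V) : TransmissionT0 (fun k x => U k x + V k x) :=
  ⟨fun k => (hU.1 k).add (hV.1 k), fun i k => by simp only [hU.2 i k, hV.2 i k]⟩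

theorem TransmissionT0.smul {n : ℕ} {U : Fin n → ℝ → ℂ} (z : ℂ) (hU : TransmissionT0 U) :
    TransmissionT0 (fun k x => z * U k x) :=
  ⟨fun k => continuousOn_const.mul (hU.1 k), fun i k => by simp only [hU.2 i k]⟩

theorem TransmissionT1.add {n : ℕ} {c : Fin n → ℝ} {U V : Fin n → ℝ → ℂ}
    (hU : TransmissionT1 c U) (hV : TransmissionT1 c V) :
    TransmissionT1 c (fun k x => U k x + V k x) := by
  refine ⟨fun k => (hU.1 k).add (hV.1 k), ?_⟩
  have e : ∀ k, derivWithin (fun x => U k x + V k x) (Ici 0) 0 =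
      derivWithin (U k) (Ici 0) 0 + derivWithin (V k) (Ici 0) 0 := fun k =>
    derivWithin_fun_add ((hU.1 k).differentiableOn (by simp) 0 self_mem_Ici)
      ((hV.1 k).differentiableOn (by simp) 0 self_mem_Ici)
  simp only [e, mul_add, Finset.sum_add_distrib, hU.2, hV.2, add_zero]

theorem TransmissionT1.smul {n : ℕ} {c : Fin n → ℝ} {U : Fin n → ℝ → ℂ} (z : ℂ)
    (hU : TransmissionT1 c U) : TransmissionT1 c (fun k x => z * U k x) := by
  refine ⟨fun k => contDiffOn_const.mul (hU.1 k), ?_⟩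
  have e : ∀ k, derivWithin (fun x => z * U k x) (Ici 0) 0 =
      z * derivWithin (U k) (Ici 0) 0 := fun k =>
    derivWithin_const_mul z ((hU.1 k).differentiableOn (by simp) 0 self_mem_Ici)
  simp only [e, mul_left_comm _ z, ← Finset.mul_sum, hU.2, mul_zero]

/-- The domain `D(A)`: the elements of `∏_{k} H²(N_k)` that satisfy `(T₀)` and `(T₁)`. The two
conditions concern the representative that is `C¹` on the closed branches. -/
def starDomain {n : ℕ} (c : Fin n → ℝ) : Submodule ℂ (StarL2 n) where
  carrier := {u | (∀ k, MemH2 (u k)) ∧ ∃ U : Fin n → ℝ → ℂ,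
    (∀ k, u k =ᵐ[volume.restrict (Ioi (0 : ℝ))] U k) ∧ TransmissionT0 U ∧ TransmissionT1 c U}
  add_mem' := by
    rintro u v ⟨hu, U, hU, hU0, hU1⟩ ⟨hv, V, hV, hV0, hV1⟩
    refine ⟨fun k => ⟨_, (hu k).hasWeakDeriv2.add (hv k).hasWeakDeriv2⟩, _, fun k => ?_,
      hU0.add hV0, hU1.add hV1⟩
    filter_upwards [Lp.coeFn_add (u k) (v k), hU k, hV k] with x h1 h2 h3
    rw [PiLp.add_apply, h1, Pi.add_apply, h2, h3]
  zero_mem' := by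
    refine ⟨fun k => ⟨0, 0, HasWeakDeriv.zero, HasWeakDeriv.zero⟩, fun _ _ => 0, fun k => ?_,
      ⟨fun k => continuousOn_const, fun i k => rfl⟩, fun k => contDiffOn_const, ?_⟩
    · exact Lp.coeFn_zero ℂ 2 (volume.restrict (Ioi (0 : ℝ)))
    · simp
  smul_mem' := by
    rintro z u ⟨hu, U, hU, hU0, hU1⟩
    refine ⟨fun k => ⟨_, (hu k).hasWeakDeriv2.smul z⟩, _, fun k => ?_, hU0.smul z, hU1.smul z⟩
    filter_upwards [Lp.coeFn_smul z (u k), hU k] with x h1 h2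
    rw [PiLp.smul_apply, h1, Pi.smul_apply, h2, smul_eq_mul]

/-- The operator `A : D(A) → H`, `(A u)_k = -c_k ∂_x² u_k + a_k u_k`. -/
def starOp {n : ℕ} (c a : Fin n → ℝ) : StarL2 n →ₗ.[ℂ] StarL2 n where
  domain := starDomain c
  toFun :=
    { toFun := fun u => WithLp.toLp 2 fun k =>
        -((c k : ℂ) • weakDeriv2 ((u : StarL2 n) k)) + (a k : ℂ) • (u : StarL2 n) k
      map_add' := by
        intro u v
        ext1 k
        have e : weakDeriv2 ((u : StarL2 n) k + (v : StarL2 n) k) =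
            weakDeriv2 ((u : StarL2 n) k) + weakDeriv2 ((v : StarL2 n) k) :=
          ((u.2.1 k).hasWeakDeriv2.add (v.2.1 k).hasWeakDeriv2).weakDeriv2_eq
        simp only [Submodule.coe_add, PiLp.add_apply, e, smul_add]
        abel
      map_smul' := by
        intro z u
        ext1 k
        have e : weakDeriv2 (z • (u : StarL2 n) k) = z • weakDeriv2 ((u : StarL2 n) k) :=
          ((u.2.1 k).hasWeakDeriv2.smul z).weakDeriv2_eq
        simp only [Submodule.coe_smul, PiLp.smul_apply, e, RingHom.id_apply, smul_add, smul_neg,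
          smul_comm z] }

/-- `R` is the resolvent `R(z, T) = (z I - T)⁻¹`, a bounded two-sided inverse of `z I - T`. -/
def IsResolvent {n : ℕ} (T : StarL2 n →ₗ.[ℂ] StarL2 n) (z : ℂ)
    (R : StarL2 n →L[ℂ] StarL2 n) : Prop :=
  (∀ f, ∃ h : R f ∈ T.domain, z • R f - T ⟨R f, h⟩ = f) ∧
    ∀ u : T.domain, R (z • (u : StarL2 n) - T u) = u

/-- The resolvent set `ρ(T)`. -/
def unboundedResolventSet {n : ℕ} (T : StarL2 n →ₗ.[ℂ] StarL2 n) : Set ℂ :=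
  {z | ∃ R, IsResolvent T z R}

/-- `κ : (0, ∞) × (0, ∞) → ℂ^{n × n}` is a kernel of the bounded operator `R` on
`H = ∏_{k} L²(N_k)`: for all `f`, `(R f)_i(x) = ∑_j ∫_0^∞ κ_{ij}(x, x') f_j(x') dx'` for almost
every `x`, the integrals being absolutely convergent. -/
def IsIntegralKernel {n : ℕ} (R : StarL2 n →L[ℂ] StarL2 n)
    (κ : ℝ → ℝ → Matrix (Fin n) (Fin n) ℂ) : Prop :=
  ∀ (f : StarL2 n) (i : Fin n), ∀ᵐ x ∂(volume.restrict (Ioi (0 : ℝ))),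
    (∀ j, IntegrableOn (fun x' => κ x x' i j * f j x') (Ioi 0)) ∧
      R f i x = ∑ j, ∫ x' in Ioi (0 : ℝ), κ x x' i j * f j x'

/-- `κ` is a kernel of the resolvent `R(z, T)`. -/
def IsResolventKernel {n : ℕ} (T : StarL2 n →ₗ.[ℂ] StarL2 n) (z : ℂ)
    (κ : ℝ → ℝ → Matrix (Fin n) (Fin n) ℂ) : Prop :=
  ∃ R, IsResolvent T z R ∧ IsIntegralKernel R κ

/-- `w ∈ ker(A_T - z I)`: a generalized eigenfunction of `A`, that is, a family of `C²` functions
on the branches which satisfies `(T₀)`, `(T₁)` and `-c_k w_k'' + a_k w_k = z w_k` on `(0, ∞)`,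
without any integrability condition at infinity. -/
def IsGenEigenfunction {n : ℕ} (c a : Fin n → ℝ) (z : ℂ) (w : Fin n → ℝ → ℂ) : Prop :=
  (∀ k, ContDiffOn ℝ 2 (w k) (Ioi 0)) ∧ TransmissionT0 w ∧ TransmissionT1 c w ∧
    ∀ k, ∀ x, 0 < x → -(c k : ℂ) * deriv (deriv (w k)) x + (a k : ℂ) * w k x = z * w k x

/-- Weidmann's form of a matrix valued kernel (at a fixed spectral parameter), built from
`w_1, …, w_p : [0, ∞) → ℂⁿ` (the components of `w q` are `w q k`) and the coefficients
`α`, `β`: the kernel is `∑_q (∑_l α_{lq} w_l(x)) w_q(x')ᵀ` for `x' ≤ x`, and the same with `β` in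
place of `α` for `x' > x`. -/
def HasWeidmannForm {n p : ℕ} (κ : ℝ → ℝ → Matrix (Fin n) (Fin n) ℂ)
    (α β : Matrix (Fin p) (Fin p) ℂ) (w : Fin p → Fin n → ℝ → ℂ) : Prop :=
  ∀ x x' : ℝ, 0 < x → 0 < x' →
    κ x x' = if x' ≤ x
      then ∑ q, Matrix.vecMulVec (∑ l, α l q • fun i => w l i x) (fun j => w q j x')
      else ∑ q, Matrix.vecMulVec (∑ l, β l q • fun i => w l i x) (fun j => w q j x')

/-- The complex square root `√(r e^{iφ}) = √r e^{iφ/2}` with `φ ∈ [-π, π)`. -/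
def branchSqrt (z : ℂ) : ℂ :=
  (Real.sqrt ‖z‖ : ℂ) *
    Complex.exp (Complex.I * (((if z.arg = Real.pi then -Real.pi else z.arg) / 2 : ℝ) : ℂ))

/-- `ξ_k(z) = √((z - a_k) / c_k)`. -/
def xi {n : ℕ} (c a : Fin n → ℝ) (z : ℂ) (k : Fin n) : ℂ := branchSqrt ((z - a k) / c k)

/-- `s_j(z) = -(∑_{l ≠ j} c_l ξ_l(z)) / (c_j ξ_j(z))`. -/
def sCoeff {n : ℕ} (c a : Fin n → ℝ) (z : ℂ) (j : Fin n) : ℂ :=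
  -(∑ l ∈ Finset.univ.erase j, (c l : ℂ) * xi c a z l) / ((c j : ℂ) * xi c a z j)

/-- The sign in the kernel: `+` if `Im z > 0`, and `-` if `Im z ≤ 0`. -/
def kernelSign (z : ℂ) : ℂ := if 0 < z.im then 1 else -1

/-- The component on the branch `N_k` of the generalized eigenfunction `F_z^{±,j}`, the sign being
the one that belongs to `z`. -/
def eigF {n : ℕ} (c a : Fin n → ℝ) (z : ℂ) (j k : Fin n) (x : ℝ) : ℂ :=
  if k = j then
    Complex.cos (xi c a z j * x) +
      kernelSign z * Complex.I * sCoeff c a z j * Complex.sin (xi c a z j * x)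
  else Complex.exp (kernelSign z * Complex.I * xi c a z k * x)

/-- `w(z) = ± i ∑_j c_j ξ_j(z)`. -/
def starWronskian {n : ℕ} (c a : Fin n → ℝ) (z : ℂ) : ℂ :=
  kernelSign z * Complex.I * ∑ j, (c j : ℂ) * xi c a z j

/-- The explicit kernel in terms of the generalized eigenfunctions `F_z^{±,j}`, as a matrix valued
function: the entry `(j, k)` is its value at `x ∈ N_j`, `x' ∈ N_k`. The successor `j + 1` is taken
modulo `n`. -/
def starKernel {n : ℕ} (c a : Fin n → ℝ) (z : ℂ) (x x' : ℝ) : Matrix (Fin n) (Fin n) ℂ :=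
  Matrix.of fun j k =>
    if k = j ∧ x < x' then
      (starWronskian c a z)⁻¹ * eigF c a z j j x * eigF c a z (finRotate n j) j x'
    else (starWronskian c a z)⁻¹ * eigF c a z (finRotate n j) j x * eigF c a z j k x'

end

/-!
**The explicit kernel.** For `z` in the resolvent set put `μ_k = ∓ i ξ_k`, so that
`c_k μ_k² = a_k - z` and `e^{± i ξ_k x} = e^{-μ_k x}`. The half-lines `[a_k, ∞)` belong to the
spectrum, since `x² e^{(-ε + i ξ) x}` on the single branch `N_k` gives approximate eigenvectors
(`not_mem_half_line_of_mem_resolventSet`); off these half-lines the chosen branch of the square root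
yields `Re μ_k > 0` for every `k` (`decayRate_re_pos`). Hence `e^{-μ_k x}` decays and
`W = -∑ c_k μ_k` has negative real part, so it is nonzero.

For a continuous compactly supported `g` on one branch, the kernel applied to `g` is a classical
`C²` solution by variation of constants. It decays exponentially with its derivatives and satisfies
the transmission conditions, so it lies in `D(A)`, and applying the resolvent to its image under
`z - A` recovers it (`IsResolvent.apply_single_of_continuous`). As the resolvent is bounded and the
rows of the kernel are square integrable, the formula passes to `L²` by density
(`IsResolvent.isIntegralKernel_starKernel`).

**No Weidmann form.** Averages of a kernel over `x' ∈ (0, 1 / (m + 1)]` are determined by the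
operator. If a kernel has Weidmann's form, letting `m → ∞` gives, for each `k`,
`∑_{l,q} α_{lq} (w_q)_k(0) (w_l)_i(x) = W⁻¹ e^{-μ_i x}` for all `i` and `x ≥ 0`
(`HasWeidmannForm.boundary_value`). The left-hand side satisfies the Kirchhoff condition in `x`; the
right-hand side does not, its Kirchhoff sum being `-W⁻¹ ∑ c_i μ_i = 1` (`not_hasWeidmannForm`).
-/

/-! ### Classical and weak derivatives -/

theorem hasWeakDeriv_of_hasDerivAt {F G : ℝ → ℂ} (hF : ∀ x, HasDerivAt F (G x) x)
    (hG : Continuous G) {f g : HalfL2} (hf : f =ᵐ[volume.restrict (Ioi (0 : ℝ))] F)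
    (hg : g =ᵐ[volume.restrict (Ioi (0 : ℝ))] G) : HasWeakDeriv f g := by
  intro φ h1 h2 h3
  have hFc : Continuous F := continuous_iff_continuousAt.2 fun x => (hF x).continuousAt
  have hd : Continuous (deriv φ) := h1.continuous_deriv (by simp)
  have i1 : Integrable (fun x => φ x • G x) :=
    (h1.continuous.smul hG).integrable_of_hasCompactSupport h2.smul_right
  have i2 : Integrable (fun x => deriv φ x • F x) :=
    (hd.smul hFc).integrable_of_hasCompactSupport h2.deriv.smul_right
  have i0 : Integrable (fun x => φ x • F x) :=
    (h1.continuous.smul hFc).integrable_of_hasCompactSupport h2.smul_right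
  have key : ∫ x, (φ x • G x + deriv φ x • F x) = 0 := by
    have hd' : ∀ x, HasDerivAt (fun x => φ x • F x) (φ x • G x + deriv φ x • F x) x := fun x => by
      have hφ : HasDerivAt φ (deriv φ x) x := (h1.differentiable (by simp) x).hasDerivAt
      exact hφ.smul (hF x)
    exact integral_eq_zero_of_hasDerivAt_of_integrable hd' (i1.add i2) i0
  rw [integral_add i1 i2] at key
  have e1 : ∫ x in Ioi (0 : ℝ), deriv φ x • f x = ∫ x, deriv φ x • F x := by
    refine Eq.trans ?_ (setIntegral_eq_integral_of_forall_compl_eq_zero (s := Ioi (0 : ℝ)) ?_)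
    · refine integral_congr_ae ?_
      filter_upwards [hf] with x hx
      rw [hx]
    · intro x hx
      have : deriv φ x = 0 := by
        by_contra h
        exact hx (h3 (support_deriv_subset h))
      rw [this, zero_smul]
  have e2 : ∫ x in Ioi (0 : ℝ), φ x • g x = ∫ x, φ x • G x := by
    refine Eq.trans ?_ (setIntegral_eq_integral_of_forall_compl_eq_zero (s := Ioi (0 : ℝ)) ?_)
    · refine integral_congr_ae ?_
      filter_upwards [hg] with x hx
      rw [hx]
    · intro x hx
      have : φ x = 0 := by
        by_contra h
        exact hx (h3 (subset_tsupport _ h))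
      rw [this, zero_smul]
  rw [e1, e2]
  linear_combination key

/-- A family of square integrable `C²` functions on the branches, with square integrable derivatives,
which satisfies both transmission conditions, is recovered by the resolvent from its image under
`z - A`. -/
theorem IsResolvent.apply_eq_toLp {n : ℕ} {c a : Fin n → ℝ} {z : ℂ} {R : StarL2 n →L[ℂ] StarL2 n}
    (hR : IsResolvent (starOp c a) z R) {U V Z : Fin n → ℝ → ℂ}
    (hU : ∀ k x, HasDerivAt (U k) (V k x) x) (hV : ∀ k x, HasDerivAt (V k) (Z k x) x)
    (hZ : ∀ k, Continuous (Z k))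
    (mU : ∀ k, MemLp (U k) 2 (volume.restrict (Ioi (0 : ℝ))))
    (mV : ∀ k, MemLp (V k) 2 (volume.restrict (Ioi (0 : ℝ))))
    (mZ : ∀ k, MemLp (Z k) 2 (volume.restrict (Ioi (0 : ℝ))))
    (h0 : ∀ i k, U i 0 = U k 0) (h1 : ∑ k, (c k : ℂ) * V k 0 = 0) {f : StarL2 n}
    (hf : ∀ k, f k =ᵐ[volume.restrict (Ioi (0 : ℝ))] fun x => (z - a k) * U k x + c k * Z k x) :
    R f = WithLp.toLp 2 fun k => (mU k).toLp (U k) := by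
  have hVc : ∀ k, Continuous (V k) := fun k =>
    continuous_iff_continuousAt.2 fun x => (hV k x).continuousAt
  have hUc : ∀ k, Continuous (U k) := fun k =>
    continuous_iff_continuousAt.2 fun x => (hU k x).continuousAt
  set u : StarL2 n := WithLp.toLp 2 fun k => (mU k).toLp (U k)
  have w2 : ∀ k, HasWeakDeriv2 (u k) ((mZ k).toLp (Z k)) := fun k =>
    ⟨(mV k).toLp (V k), hasWeakDeriv_of_hasDerivAt (hU k) (hVc k) (mU k).coeFn_toLp
      (mV k).coeFn_toLp, hasWeakDeriv_of_hasDerivAt (hV k) (hZ k) (mV k).coeFn_toLp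
      (mZ k).coeFn_toLp⟩
  have hud : u ∈ (starOp c a).domain := by
    refine ⟨fun k => ⟨_, w2 k⟩, U, fun k => (mU k).coeFn_toLp,
      ⟨fun k => (hUc k).continuousOn, h0⟩, fun k => ?_, ?_⟩
    · refine ContDiff.contDiffOn ?_
      rw [contDiff_one_iff_deriv]
      refine ⟨fun x => (hU k x).differentiableAt, ?_⟩
      rw [show deriv (U k) = V k from funext fun x => (hU k x).deriv]
      exact hVc k
    · rw [← h1]
      refine Finset.sum_congr rfl fun k _ => ?_
      rw [(hU k 0).hasDerivWithinAt.derivWithin (uniqueDiffOn_Ici 0 0 self_mem_Ici)]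
  have hfu : z • u - starOp c a ⟨u, hud⟩ = f := by
    ext1 k
    have e : starOp c a ⟨u, hud⟩ k =
        -((c k : ℂ) • (mZ k).toLp (Z k)) + (a k : ℂ) • (mU k).toLp (U k) := by
      have := (w2 k).weakDeriv2_eq
      change -((c k : ℂ) • weakDeriv2 (u k)) + (a k : ℂ) • u k = _
      rw [this]
    rw [PiLp.sub_apply, PiLp.smul_apply, e]
    have e' : z • u k - (-((c k : ℂ) • (mZ k).toLp (Z k)) + (a k : ℂ) • (mU k).toLp (U k)) =
        (z - a k) • (mU k).toLp (U k) + (c k : ℂ) • (mZ k).toLp (Z k) := by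
      rw [sub_smul]
      change z • (mU k).toLp (U k) - _ = _
      abel
    rw [e']
    refine Lp.ext ?_
    filter_upwards [Lp.coeFn_add ((z - a k) • (mU k).toLp (U k)) ((c k : ℂ) • (mZ k).toLp (Z k)),
      Lp.coeFn_smul (z - a k) ((mU k).toLp (U k)), Lp.coeFn_smul (c k : ℂ) ((mZ k).toLp (Z k)),
      (mU k).coeFn_toLp, (mZ k).coeFn_toLp, hf k] with x h1 h2 h3 h4 h5 h6
    rw [h1, h6, Pi.add_apply, h2, h3, Pi.smul_apply, Pi.smul_apply, h4, h5, smul_eq_mul,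
      smul_eq_mul]
  have := hR.2 ⟨u, hud⟩
  rw [hfu] at this
  exact this

theorem IsResolvent.unique {n : ℕ} {T : StarL2 n →ₗ.[ℂ] StarL2 n} {z : ℂ}
    {R R' : StarL2 n →L[ℂ] StarL2 n} (h : IsResolvent T z R) (h' : IsResolvent T z R') :
    R = R' := by
  ext1 f
  obtain ⟨hm, hf⟩ := h'.1 f
  have := h.2 ⟨R' f, hm⟩
  rwa [hf] at this

theorem HalfL2.norm_sq_eq (f : HalfL2) : ‖f‖ ^ 2 = ∫ x in Ioi (0 : ℝ), ‖f x‖ ^ 2 := by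
  have h := L2.inner_def (𝕜 := ℂ) f f
  rw [inner_self_eq_norm_sq_to_K] at h
  have h2 : (((∫ x in Ioi (0 : ℝ), ‖f x‖ ^ 2 : ℝ)) : ℂ) = ((‖f‖ ^ 2 : ℝ) : ℂ) := by
    rw [← integral_complex_ofReal, Complex.ofReal_pow]
    refine Eq.trans (integral_congr_ae (ae_of_all _ fun x => ?_)) h.symm
    simp only [inner_self_eq_norm_sq_to_K]
    simp
  exact_mod_cast h2.symm

/-! ### The spectrum contains the half-lines `[a_k, ∞)` -/

theorem integral_pow_mul_exp_neg (k : ℕ) {r : ℝ} (hr : 0 < r) :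
    ∫ x in Ioi (0 : ℝ), x ^ k * Real.exp (-(r * x)) = k.factorial / r ^ (k + 1) := by
  have h := Real.integral_rpow_mul_exp_neg_mul_Ioi (a := (k : ℝ) + 1) (r := r) (by positivity) hr
  rw [Real.Gamma_nat_eq_factorial, add_sub_cancel_right] at h
  simp only [Real.rpow_natCast] at h
  rw [h, ← Nat.cast_add_one, Real.rpow_natCast, one_div, inv_pow]
  field_simp

theorem integrableOn_pow_mul_exp_neg (k : ℕ) {r : ℝ} (hr : 0 < r) :
    IntegrableOn (fun x => x ^ k * Real.exp (-(r * x))) (Ioi (0 : ℝ)) := by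
  refine Integrable.of_integral_ne_zero ?_
  rw [integral_pow_mul_exp_neg k hr]
  positivity

theorem norm_sq_pow_mul_cexp (k : ℕ) (ν : ℂ) (x : ℝ) :
    ‖(x : ℂ) ^ k * Complex.exp (ν * x)‖ ^ 2 = x ^ (2 * k) * Real.exp (-(-2 * ν.re * x)) := by
  rw [norm_mul, norm_pow, Complex.norm_real, Complex.norm_exp, mul_pow, ← Real.exp_nat_mul,
    ← pow_mul, mul_comm k 2, pow_mul, Real.norm_eq_abs, sq_abs, ← pow_mul]
  congr 2
  simp
  ring

theorem memLp_pow_mul_cexp (k : ℕ) {ν : ℂ} (hν : ν.re < 0) :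
    MemLp (fun x : ℝ => (x : ℂ) ^ k * Complex.exp (ν * x)) 2 (volume.restrict (Ioi (0 : ℝ))) := by
  rw [memLp_two_iff_integrable_sq_norm
    (Continuous.aestronglyMeasurable (by fun_prop))]
  simp only [norm_sq_pow_mul_cexp]
  exact integrableOn_pow_mul_exp_neg _ (by linarith)

theorem memLp_quadratic_mul_cexp (p q r : ℂ) {ν : ℂ} (hν : ν.re < 0) :
    MemLp (fun x : ℝ => (p + q * x + r * x ^ 2) * Complex.exp (ν * x)) 2
      (volume.restrict (Ioi (0 : ℝ))) := by
  refine (((memLp_pow_mul_cexp 0 hν).const_mul p).add (((memLp_pow_mul_cexp 1 hν).const_mul q).add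
    ((memLp_pow_mul_cexp 2 hν).const_mul r))).ae_eq (ae_of_all _ fun x => ?_)
  simp only [Pi.add_apply]
  ring

theorem hasDerivAt_quadratic_mul_cexp (p q r ν : ℂ) (x : ℝ) :
    HasDerivAt (fun x : ℝ => (p + q * x + r * x ^ 2) * Complex.exp (ν * x))
      (((q + ν * p) + (2 * r + ν * q) * x + (ν * r) * x ^ 2) * Complex.exp (ν * x)) x := by
  have h : HasDerivAt (fun y : ℂ => (p + q * y + r * y ^ 2) * Complex.exp (ν * y))
      (((q + ν * p) + (2 * r + ν * q) * x + (ν * r) * x ^ 2) * Complex.exp (ν * x)) (x : ℂ) := by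
    have h1 : HasDerivAt (fun y : ℂ => ν * y) ν (x : ℂ) := by
      simpa using (hasDerivAt_id (x : ℂ)).const_mul ν
    have h2 : HasDerivAt (fun y : ℂ => q * y) q (x : ℂ) := by
      simpa using (hasDerivAt_id (x : ℂ)).const_mul q
    have h3 : HasDerivAt (fun y : ℂ => r * y ^ 2) (r * (2 * x)) (x : ℂ) := by
      simpa using (hasDerivAt_pow 2 (x : ℂ)).const_mul r
    refine (((h2.const_add p).add h3).mul h1.cexp).congr_deriv ?_
    simp only [Pi.add_apply]
    ring
  exact h.comp_ofReal

/-- The bound `‖u‖² ≤ ‖R‖² ‖(z - A) u‖²` for the element `u` of `D(A)` which is `x² e^{ν x}` on `N_k`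
and zero on the other branches. The left-hand side is `‖u‖² = ∫ x⁴ e^{2 (Re ν) x} dx`. Both
transmission conditions hold as `u` and `u'` vanish at the node. -/
theorem IsResolvent.norm_sq_le_mul_integral {n : ℕ} {c a : Fin n → ℝ} {z : ℂ}
    {R : StarL2 n →L[ℂ] StarL2 n}
    (hR : IsResolvent (starOp c a) z R) (k : Fin n) {ν : ℂ} (hν : ν.re < 0) :
    24 / (-2 * ν.re) ^ 5 ≤ ‖R‖ ^ 2 * ∫ x in Ioi (0 : ℝ), ‖(2 * c k + 4 * c k * ν * x +
      (z - a k + c k * ν ^ 2) * x ^ 2) * Complex.exp (ν * x)‖ ^ 2 := by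
  classical
  have mf := memLp_quadratic_mul_cexp (2 * c k) (4 * c k * ν) (z - a k + c k * ν ^ 2) hν
  set f : HalfL2 := mf.toLp _ with hf
  let U : Fin n → ℝ → ℂ := fun j x =>
    if j = k then (0 + 0 * x + 1 * x ^ 2) * Complex.exp (ν * x) else 0
  let V : Fin n → ℝ → ℂ := fun j x =>
    if j = k then ((0 + ν * 0) + (2 * 1 + ν * 0) * x + (ν * 1) * x ^ 2) * Complex.exp (ν * x) else 0
  let Z : Fin n → ℝ → ℂ := fun j x =>
    if j = k then (((2 * 1 + ν * 0) + ν * (0 + ν * 0)) + (2 * (ν * 1) + ν * (2 * 1 + ν * 0)) * x +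
      (ν * (ν * 1)) * x ^ 2) * Complex.exp (ν * x) else 0
  have hU : ∀ j x, HasDerivAt (U j) (V j x) x := by
    intro j x
    by_cases h : j = k
    · simpa only [U, V, h, if_true] using hasDerivAt_quadratic_mul_cexp 0 0 1 ν x
    · simpa only [U, V, h, if_false] using hasDerivAt_const x (0 : ℂ)
  have hV : ∀ j x, HasDerivAt (V j) (Z j x) x := by
    intro j x
    by_cases h : j = k
    · simpa only [Z, V, h, if_true] using
        hasDerivAt_quadratic_mul_cexp (0 + ν * 0) (2 * 1 + ν * 0) (ν * 1) ν x
    · simpa only [Z, V, h, if_false] using hasDerivAt_const x (0 : ℂ)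
  have m0 : MemLp (fun _ : ℝ => (0 : ℂ)) 2 (volume.restrict (Ioi (0 : ℝ))) := MemLp.zero'
  have mU : ∀ j, MemLp (U j) 2 (volume.restrict (Ioi (0 : ℝ))) := by
    intro j
    by_cases h : j = k
    · simpa only [U, h, if_true] using memLp_quadratic_mul_cexp 0 0 1 hν
    · simpa only [U, h, if_false] using m0
  have mV : ∀ j, MemLp (V j) 2 (volume.restrict (Ioi (0 : ℝ))) := by
    intro j
    by_cases h : j = k
    · simpa only [V, h, if_true] using memLp_quadratic_mul_cexp _ _ _ hν
    · simpa only [V, h, if_false] using m0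
  have mZ : ∀ j, MemLp (Z j) 2 (volume.restrict (Ioi (0 : ℝ))) := by
    intro j
    by_cases h : j = k
    · simpa only [Z, h, if_true] using memLp_quadratic_mul_cexp _ _ _ hν
    · simpa only [Z, h, if_false] using m0
  have hZ : ∀ j, Continuous (Z j) := by
    intro j
    by_cases h : j = k
    · simp only [Z, h, if_true]; fun_prop
    · simp only [Z, h, if_false]; fun_prop
  have key := hR.apply_eq_toLp hU hV hZ mU mV mZ (by simp [U]) (by simp [V])
    (f := PiLp.single 2 k f) ?_
  · have hn1 : ‖(mU k).toLp (U k)‖ ≤ ‖R‖ * ‖f‖ := by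
      have h1 := R.le_opNorm (PiLp.single 2 k f)
      rw [PiLp.norm_single] at h1
      refine le_trans ?_ h1
      rw [key]
      exact PiLp.norm_apply_le (WithLp.toLp 2 fun k => (mU k).toLp (U k)) k
    have hn2 : ‖(mU k).toLp (U k)‖ ^ 2 ≤ ‖R‖ ^ 2 * ‖f‖ ^ 2 := by
      rw [← mul_pow]
      gcongr
    rw [HalfL2.norm_sq_eq, HalfL2.norm_sq_eq] at hn2
    have e1 : ∫ x in Ioi (0 : ℝ), ‖(mU k).toLp (U k) x‖ ^ 2 = 24 / (-2 * ν.re) ^ 5 := by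
      rw [show (24 : ℝ) = ((4 : ℕ).factorial : ℝ) by norm_num [Nat.factorial],
        ← integral_pow_mul_exp_neg 4 (r := -2 * ν.re) (by linarith)]
      refine integral_congr_ae ?_
      filter_upwards [(mU k).coeFn_toLp] with x hx
      rw [hx, show 4 = 2 * 2 by norm_num, ← norm_sq_pow_mul_cexp]
      simp [U]
    have e2 : ∫ x in Ioi (0 : ℝ), ‖f x‖ ^ 2 = ∫ x in Ioi (0 : ℝ), ‖(2 * c k + 4 * c k * ν * x +
        (z - a k + c k * ν ^ 2) * x ^ 2) * Complex.exp (ν * x)‖ ^ 2 := by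
      refine integral_congr_ae ?_
      filter_upwards [mf.coeFn_toLp] with x hx
      rw [hf, hx]
    rwa [e1, e2] at hn2
  · intro j
    by_cases h : j = k
    · subst h
      filter_upwards [mf.coeFn_toLp] with x hx
      rw [PiLp.single_apply, if_pos rfl, hf, hx]
      simp only [U, Z, if_true]
      ring
    · filter_upwards [Lp.coeFn_zero ℂ 2 (volume.restrict (Ioi (0 : ℝ)))] with x hx
      rw [PiLp.single_apply, if_neg h, hx]
      simp [U, Z, h]

theorem norm_quadratic_mul_sq_le (p q r e : ℂ) (x : ℝ) :
    ‖(p + q * x + r * x ^ 2) * e‖ ^ 2 ≤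
      3 * (‖p‖ ^ 2 + ‖q‖ ^ 2 * x ^ 2 + ‖r‖ ^ 2 * x ^ 4) * ‖e‖ ^ 2 := by
  rw [norm_mul, mul_pow]
  gcongr
  have h : ‖p + q * x + r * x ^ 2‖ ≤ ‖p‖ + ‖q‖ * |x| + ‖r‖ * |x| ^ 2 := by
    refine (norm_add₃_le).trans_eq ?_
    simp [Complex.norm_real]
  have h2 : |x| ^ 2 = x ^ 2 := sq_abs x
  have h4 : x ^ 4 = (|x| ^ 2) ^ 2 := by rw [h2]; ring
  calc _ ≤ (‖p‖ + ‖q‖ * |x| + ‖r‖ * |x| ^ 2) ^ 2 := by gcongr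
    _ ≤ _ := by
      rw [← h2, h4]
      nlinarith [sq_nonneg (‖p‖ - ‖q‖ * |x|), sq_nonneg (‖p‖ - ‖r‖ * |x| ^ 2),
        sq_nonneg (‖q‖ * |x| - ‖r‖ * |x| ^ 2)]

/-- The half-lines `[a_k, ∞)` lie in the spectrum. With `z = a_k + c_k ξ²`, the functions
`x² e^{(-ε + i ξ) x}` are approximate eigenvectors: as `ε → 0`, the square of their norm grows like
`ε⁻⁵`, and the square of the norm of their image under `z - A` only like `ε⁻³`. -/
theorem not_mem_half_line_of_mem_resolventSet {n : ℕ} {c a : Fin n → ℝ} (hc : ∀ k, 0 < c k) {z : ℂ}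
    (hz : z ∈ unboundedResolventSet (starOp c a)) (k : Fin n) : ¬ (z.im = 0 ∧ a k ≤ z.re) := by
  rintro ⟨him, hre⟩
  obtain ⟨R, hR⟩ := hz
  have hck := hc k
  -- `ξ` is real, so that `e^{i ξ x}` is a bounded solution on `N_k`.
  set ξ := Real.sqrt ((z.re - a k) / c k) with hξ
  have hξ2 : (z.re - a k) = c k * ξ ^ 2 := by
    rw [hξ, Real.sq_sqrt (div_nonneg (by linarith) hck.le)]
    field_simp
  have hz2 : z - a k = c k * ξ ^ 2 := by
    apply Complex.ext
    · simpa [← Complex.ofReal_pow] using hξ2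
    · simpa [← Complex.ofReal_pow] using him
  have main : ∀ ε : ℝ, 0 < ε → ε ≤ 1 → 24 ≤ (1000 * ‖R‖ ^ 2 * c k ^ 2 * (1 + ξ ^ 2)) * ε := by
    intro ε hε hε1
    set ν : ℂ := ⟨-ε, ξ⟩ with hνd
    have hν : ν.re < 0 := by simpa [hνd] using hε
    have h := hR.norm_sq_le_mul_integral k hν
    have hνn : ‖ν‖ ^ 2 ≤ 1 + ξ ^ 2 := by
      rw [Complex.sq_norm, Complex.normSq_apply]
      simp only [hνd]
      nlinarith
    -- `ξ² + ν² = ε (ε - 2 i ξ)`: the coefficient of `x²` is of order `ε`.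
    have hr : z - a k + c k * ν ^ 2 = c k * ε * (⟨ε, -2 * ξ⟩ : ℂ) := by
      rw [hz2]
      apply Complex.ext
      · simp [hνd, pow_two]; ring
      · simp [hνd, pow_two]; ring
    have hrn : ‖z - a k + c k * ν ^ 2‖ ^ 2 ≤ c k ^ 2 * ε ^ 2 * (4 * (1 + ξ ^ 2)) := by
      have : ‖(⟨ε, -2 * ξ⟩ : ℂ)‖ ^ 2 ≤ 4 * (1 + ξ ^ 2) := by
        rw [Complex.sq_norm, Complex.normSq_apply]
        simp only
        nlinarith
      rw [hr, norm_mul, norm_mul, mul_pow, mul_pow, Complex.norm_real, Complex.norm_real,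
        Real.norm_eq_abs, Real.norm_eq_abs, sq_abs, sq_abs]
      gcongr
    have hpn : ‖(2 * c k : ℂ)‖ ^ 2 = 4 * c k ^ 2 := by
      rw [norm_mul, mul_pow, Complex.norm_real, Real.norm_eq_abs, sq_abs]
      norm_num
    have hqn : ‖4 * c k * ν‖ ^ 2 ≤ 16 * c k ^ 2 * (1 + ξ ^ 2) := by
      rw [norm_mul, mul_pow, norm_mul, mul_pow, Complex.norm_real, Real.norm_eq_abs, sq_abs]
      norm_num
      gcongr
    have hr2 : 0 < -2 * ν.re := by linarith
    have i0 := integrableOn_pow_mul_exp_neg 0 hr2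
    have i2 := integrableOn_pow_mul_exp_neg 2 hr2
    have i4 := integrableOn_pow_mul_exp_neg 4 hr2
    have hle : ∫ x in Ioi (0 : ℝ), ‖(2 * c k + 4 * c k * ν * x +
        (z - a k + c k * ν ^ 2) * x ^ 2) * Complex.exp (ν * x)‖ ^ 2 ≤
        ∫ x in Ioi (0 : ℝ), (12 * c k ^ 2 * (x ^ 0 * Real.exp (-(-2 * ν.re * x))) +
          48 * c k ^ 2 * (1 + ξ ^ 2) * (x ^ 2 * Real.exp (-(-2 * ν.re * x))) +
          12 * c k ^ 2 * ε ^ 2 * (1 + ξ ^ 2) * (x ^ 4 * Real.exp (-(-2 * ν.re * x)))) := by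
      refine integral_mono_of_nonneg (ae_of_all _ fun x => by positivity)
        (((i0.const_mul _).add (i2.const_mul _)).add (i4.const_mul _)) (ae_of_all _ fun x => ?_)
      refine (norm_quadratic_mul_sq_le _ _ _ _ x).trans ?_
      have he : ‖Complex.exp (ν * x)‖ ^ 2 = Real.exp (-(-2 * ν.re * x)) := by
        simpa using norm_sq_pow_mul_cexp 0 ν x
      rw [he, hpn]
      calc _ ≤ 3 * (4 * c k ^ 2 + 16 * c k ^ 2 * (1 + ξ ^ 2) * x ^ 2 +
            c k ^ 2 * ε ^ 2 * (4 * (1 + ξ ^ 2)) * x ^ 4) * Real.exp (-(-2 * ν.re * x)) := by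
            gcongr
        _ = _ := by ring
    have j2 := (i2.const_mul (48 * c k ^ 2 * (1 + ξ ^ 2)))
    have j4 := (i4.const_mul (12 * c k ^ 2 * ε ^ 2 * (1 + ξ ^ 2)))
    have j02 : Integrable (fun x => 12 * c k ^ 2 * (x ^ 0 * Real.exp (-(-2 * ν.re * x))) +
        48 * c k ^ 2 * (1 + ξ ^ 2) * (x ^ 2 * Real.exp (-(-2 * ν.re * x))))
        (volume.restrict (Ioi (0 : ℝ))) := (i0.const_mul (12 * c k ^ 2)).add j2
    rw [integral_add j02 j4, integral_add (i0.const_mul _) j2, integral_const_mul, integral_const_mul,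
      integral_const_mul, integral_pow_mul_exp_neg 0 hr2, integral_pow_mul_exp_neg 2 hr2,
      integral_pow_mul_exp_neg 4 hr2] at hle
    have h3 := h.trans (mul_le_mul_of_nonneg_left hle (sq_nonneg ‖R‖))
    have hνe : -2 * ν.re = 2 * ε := by simp [hνd]
    rw [hνe, div_le_iff₀ (by positivity)] at h3
    norm_num [Nat.factorial] at h3
    refine h3.trans ?_
    have e : ‖R‖ ^ 2 * (12 * c k ^ 2 * (1 / (2 * ε)) +
        48 * c k ^ 2 * (1 + ξ ^ 2) * (2 / (2 * ε) ^ 3) +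
        12 * c k ^ 2 * ε ^ 2 * (1 + ξ ^ 2) * (24 / (2 * ε) ^ 5)) * (2 * ε) ^ 5 =
        ‖R‖ ^ 2 * c k ^ 2 * (192 * ε ^ 4 + 672 * (1 + ξ ^ 2) * ε ^ 2) := by
      field_simp
      ring
    have e4 : ε ^ 4 ≤ ε := pow_le_of_le_one hε.le hε1 (by norm_num)
    have e2 : ε ^ 2 ≤ ε := pow_le_of_le_one hε.le hε1 (by norm_num)
    have e5 : 192 * ε ^ 4 + 672 * (1 + ξ ^ 2) * ε ^ 2 ≤ 1000 * (1 + ξ ^ 2) * ε := by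
      have : (1 + ξ ^ 2) * ε ^ 2 ≤ (1 + ξ ^ 2) * ε := by gcongr
      nlinarith [sq_nonneg ξ, mul_nonneg (sq_nonneg ξ) hε.le]
    have e6 := mul_le_mul_of_nonneg_left e5 (by positivity : 0 ≤ ‖R‖ ^ 2 * c k ^ 2)
    simp only [one_div] at e
    norm_num at e ⊢
    linarith
  -- The right-hand side tends to zero with `ε`.
  set K := 1000 * ‖R‖ ^ 2 * c k ^ 2 * (1 + ξ ^ 2) with hK
  have hK0 : 0 ≤ K := by positivity
  have := main (1 / (K + 1)) (by positivity) (by rw [div_le_one (by positivity)]; linarith)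
  rw [mul_one_div, le_div_iff₀ (by positivity)] at this
  linarith

/-! ### The branch of the square root -/

theorem branchSqrt_sq (z : ℂ) : branchSqrt z ^ 2 = z := by
  have h : Complex.exp (Complex.I * (((if z.arg = Real.pi then -Real.pi else z.arg : ℝ)) : ℂ)) =
      Complex.exp (z.arg * Complex.I) := by
    split_ifs with h
    · rw [h, Complex.exp_pi_mul_I, Complex.ofReal_neg, mul_neg, mul_comm, Complex.exp_neg,
        Complex.exp_pi_mul_I]
      norm_num
    · rw [mul_comm]
  rw [branchSqrt, mul_pow, ← Complex.ofReal_pow, Real.sq_sqrt (norm_nonneg z),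
    ← Complex.exp_nat_mul]
  conv_rhs => rw [← Complex.norm_mul_exp_arg_mul_I z, ← h]
  congr 2
  push_cast
  ring

theorem branchSqrt_im (z : ℂ) : (branchSqrt z).im =
    Real.sqrt ‖z‖ * Real.sin ((if z.arg = Real.pi then -Real.pi else z.arg) / 2) := by
  rw [branchSqrt, Complex.im_ofReal_mul, mul_comm Complex.I, Complex.exp_ofReal_mul_I_im]

theorem branchSqrt_im_pos {z : ℂ} (hz : 0 < z.im) : 0 < (branchSqrt z).im := by
  have h0 : 0 < z.arg := lt_of_le_of_ne (Complex.arg_nonneg_iff.2 hz.le)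
    fun h => hz.ne' (Complex.arg_eq_zero_iff.1 h.symm).2
  have hpi : z.arg ≠ Real.pi := fun h => hz.ne' (Complex.arg_eq_pi_iff.1 h).2
  have hle := Complex.arg_le_pi z
  rw [branchSqrt_im, if_neg hpi]
  have : z ≠ 0 := fun h => by simp [h] at hz
  exact mul_pos (Real.sqrt_pos.2 (norm_pos_iff.2 this))
    (Real.sin_pos_of_pos_of_lt_pi (by linarith) (by linarith))

/-- On the negative real axis the branch is `-i √|z|`, so it still has negative imaginary part. -/
theorem branchSqrt_im_neg {z : ℂ} (hz : z.im ≤ 0) (h : ¬(z.im = 0 ∧ 0 ≤ z.re)) :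
    (branchSqrt z).im < 0 := by
  have hz0 : z ≠ 0 := fun h0 => h (by simp [h0])
  rw [branchSqrt_im]
  refine mul_neg_of_pos_of_neg (Real.sqrt_pos.2 (norm_pos_iff.2 hz0)) ?_
  have hpi := Real.pi_pos
  have hgt := Complex.neg_pi_lt_arg z
  split_ifs with h1
  · exact Real.sin_neg_of_neg_of_neg_pi_lt (by linarith) (by linarith)
  · have : z.arg < 0 := by
      rcases hz.lt_or_eq with h2 | h2
      · exact Complex.arg_neg_iff.2 h2
      · exact absurd (Complex.arg_eq_pi_iff.2 ⟨not_le.1 fun h3 => h ⟨h2, h3⟩, h2⟩) h1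
    exact Real.sin_neg_of_neg_of_neg_pi_lt (by linarith) (by linarith)

/-! ### Decay rates and the kernel in terms of them -/

section Rates

variable {n : ℕ} (c a : Fin n → ℝ) (z : ℂ)

/-- The rate `μ_k = ∓ i ξ_k`, so that `e^{± i ξ_k x} = e^{-μ_k x}`. It is the root of
`c_k μ² = a_k - z` which has positive real part when `z ∉ [a_k, ∞)`. -/
noncomputable def decayRate (k : Fin n) : ℂ := -(kernelSign z * Complex.I * xi c a z k)

/-- The coefficient of `sinh` in the `j`-th component of the generalized eigenfunction `F^j`; it
makes `F^j` satisfy the Kirchhoff condition. -/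
noncomputable def sinhCoeff (j : Fin n) : ℂ :=
  (∑ l ∈ Finset.univ.erase j, (c l : ℂ) * decayRate c a z l) / ((c j : ℂ) * decayRate c a z j)

/-- The solution `e^{-μ_k x}` of the eigenvalue equation on `N_k`, which decays at infinity. -/
noncomputable def decaySol (k : Fin n) (x : ℝ) : ℂ := Complex.exp (-decayRate c a z k * x)

/-- The component of `F^k` on `N_k` itself, written with hyperbolic functions. -/
noncomputable def growSol (k : Fin n) (x : ℝ) : ℂ :=
  Complex.cosh (decayRate c a z k * x) + sinhCoeff c a z k * Complex.sinh (decayRate c a z k * x)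

/-- The derivative of `growSol` in `x`. -/
noncomputable def growSolDeriv (k : Fin n) (x : ℝ) : ℂ := decayRate c a z k *
  (Complex.sinh (decayRate c a z k * x) + sinhCoeff c a z k * Complex.cosh (decayRate c a z k * x))

variable {c a z}

theorem kernelSign_mul_self : kernelSign z * kernelSign z = 1 := by
  unfold kernelSign
  split_ifs <;> norm_num

theorem decayRate_sq (hc : ∀ k, 0 < c k) (k : Fin n) :
    (c k : ℂ) * decayRate c a z k ^ 2 = a k - z := by
  have hck : (c k : ℂ) ≠ 0 := Complex.ofReal_ne_zero.2 (hc k).ne'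
  have h : decayRate c a z k ^ 2 = -(xi c a z k ^ 2) := by
    unfold decayRate
    linear_combination (Complex.I ^ 2 * xi c a z k ^ 2) * kernelSign_mul_self (z := z) +
      xi c a z k ^ 2 * Complex.I_sq
  rw [h, xi, branchSqrt_sq]
  field_simp
  ring

theorem xi_eq (k : Fin n) : xi c a z k = kernelSign z * Complex.I * decayRate c a z k := by
  unfold decayRate
  linear_combination -(xi c a z k) * kernelSign_mul_self (z := z) +
    (kernelSign z * kernelSign z * xi c a z k) * Complex.I_sq

theorem decayRate_re_pos (hc : ∀ k, 0 < c k) (k : Fin n) (hz : ¬ (z.im = 0 ∧ a k ≤ z.re)) :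
    0 < (decayRate c a z k).re := by
  have him : ((z - a k) / c k).im = z.im / c k := by
    rw [Complex.div_ofReal_im]; simp
  have hre : ((z - a k) / c k).re = (z.re - a k) / c k := by
    rw [Complex.div_ofReal_re]; simp
  unfold decayRate kernelSign xi
  split_ifs with h
  · have := branchSqrt_im_pos (z := (z - a k) / c k) (by rw [him]; exact div_pos h (hc k))
    simpa using this
  · have := branchSqrt_im_neg (z := (z - a k) / c k)
      (by rw [him]; exact div_nonpos_of_nonpos_of_nonneg (not_lt.1 h) (hc k).le) ?_
    · simpa using this
    · rw [him, hre]
      rintro ⟨h1, h2⟩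
      refine hz ⟨(div_eq_zero_iff.1 h1).resolve_right (hc k).ne', ?_⟩
      have := (le_div_iff₀ (hc k)).1 h2
      linarith
 

theorem eigF_of_ne {j k : Fin n} (h : k ≠ j) (x : ℝ) : eigF c a z j k x = decaySol c a z k x := by
  rw [eigF, if_neg h, decaySol, decayRate, neg_neg]

theorem sCoeff_eq (j : Fin n) : sCoeff c a z j = -sinhCoeff c a z j := by
  have hs : kernelSign z * Complex.I ≠ 0 := by
    refine mul_ne_zero (fun h => ?_) Complex.I_ne_zero
    have := kernelSign_mul_self (z := z)
    rw [h] at this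
    norm_num at this
  rw [sCoeff, sinhCoeff, neg_div]
  have e : ∑ l ∈ Finset.univ.erase j, (c l : ℂ) * xi c a z l =
      (kernelSign z * Complex.I) * ∑ l ∈ Finset.univ.erase j, (c l : ℂ) * decayRate c a z l := by
    rw [Finset.mul_sum]
    refine Finset.sum_congr rfl fun l _ => ?_
    rw [xi_eq l]
    ring
  rw [e, xi_eq j, mul_left_comm (c j : ℂ), mul_div_mul_left _ _ hs]

theorem eigF_self (j : Fin n) (x : ℝ) : eigF c a z j j x = growSol c a z j x := by
  rw [eigF, if_pos rfl, growSol, sCoeff_eq, xi_eq]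
  unfold kernelSign
  have e1 : (Complex.I * decayRate c a z j * x) = (decayRate c a z j * x) * Complex.I := by ring
  split_ifs
  · rw [one_mul, e1, Complex.cos_mul_I, Complex.sin_mul_I]
    linear_combination (-sinhCoeff c a z j * Complex.sinh (decayRate c a z j * x)) * Complex.I_sq
  · rw [neg_one_mul, neg_mul, neg_mul, Complex.cos_neg, Complex.sin_neg, e1, Complex.cos_mul_I,
      Complex.sin_mul_I]
    linear_combination (-sinhCoeff c a z j * Complex.sinh (decayRate c a z j * x)) * Complex.I_sq

theorem starWronskian_eq : starWronskian c a z = -∑ k, (c k : ℂ) * decayRate c a z k := by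
  rw [starWronskian, Finset.mul_sum, ← Finset.sum_neg_distrib]
  refine Finset.sum_congr rfl fun k _ => ?_
  rw [decayRate]
  ring

theorem starWronskian_ne_zero (hn : 2 ≤ n) (hc : ∀ k, 0 < c k)
    (hμ : ∀ k, 0 < (decayRate c a z k).re) : starWronskian c a z ≠ 0 := by
  intro h
  have h1 := congrArg Complex.re h
  rw [starWronskian_eq, Complex.neg_re, Complex.re_sum, Complex.zero_re, neg_eq_zero] at h1
  simp only [Complex.re_ofReal_mul] at h1
  have : Nonempty (Fin n) := ⟨⟨0, by omega⟩⟩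
  exact (Finset.sum_pos (fun k _ => mul_pos (hc k) (hμ k)) Finset.univ_nonempty).ne' h1

/-- Up to the factor `c_k`, the left-hand side is the Wronskian of `decaySol` and `growSol` at
`x = 0`. -/
theorem mul_one_add_sinhCoeff (hc : ∀ k, 0 < c k) (hμ : ∀ k, 0 < (decayRate c a z k).re)
    (k : Fin n) : (c k : ℂ) * decayRate c a z k * (1 + sinhCoeff c a z k) =
      -starWronskian c a z := by
  have h1 : (c k : ℂ) * decayRate c a z k ≠ 0 := by
    refine mul_ne_zero (Complex.ofReal_ne_zero.2 (hc k).ne') fun h => ?_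
    have := hμ k
    rw [h] at this
    exact lt_irrefl _ this
  rw [starWronskian_eq, neg_neg, sinhCoeff, mul_add, mul_one, mul_div_cancel₀ _ h1]
  exact Finset.add_sum_erase _ (fun l => (c l : ℂ) * decayRate c a z l) (Finset.mem_univ k)

theorem finRotate_ne_self (hn : 2 ≤ n) (j : Fin n) : finRotate n j ≠ j := by
  obtain ⟨m, rfl⟩ : ∃ m, n = m + 2 := ⟨n - 2, by omega⟩
  rw [finRotate_apply]
  simp

theorem starKernel_of_ne (hn : 2 ≤ n) {i k : Fin n} (h : k ≠ i) (x x' : ℝ) :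
    starKernel c a z x x' i k =
      (starWronskian c a z)⁻¹ * decaySol c a z i x * decaySol c a z k x' := by
  rw [starKernel, Matrix.of_apply, if_neg fun h' => h h'.1, eigF_of_ne (finRotate_ne_self hn i).symm,
    eigF_of_ne h]

theorem starKernel_self_of_lt (hn : 2 ≤ n) (k : Fin n) {x x' : ℝ} (h : x < x') :
    starKernel c a z x x' k k =
      (starWronskian c a z)⁻¹ * growSol c a z k x * decaySol c a z k x' := by
  rw [starKernel, Matrix.of_apply, if_pos ⟨rfl, h⟩, eigF_of_ne (finRotate_ne_self hn k).symm,
    eigF_self]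

theorem starKernel_self_of_le (hn : 2 ≤ n) (k : Fin n) {x x' : ℝ} (h : x' ≤ x) :
    starKernel c a z x x' k k =
      (starWronskian c a z)⁻¹ * decaySol c a z k x * growSol c a z k x' := by
  rw [starKernel, Matrix.of_apply, if_neg fun h' => not_lt.2 h h'.2,
    eigF_of_ne (finRotate_ne_self hn k).symm, eigF_self]

@[simp] theorem decaySol_zero (k : Fin n) : decaySol c a z k 0 = 1 := by simp [decaySol]

@[simp] theorem growSol_zero (k : Fin n) : growSol c a z k 0 = 1 := by simp [growSol]

theorem hasDerivAt_decaySol (k : Fin n) (x : ℝ) :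
    HasDerivAt (decaySol c a z k) (-decayRate c a z k * decaySol c a z k x) x := by
  have h : HasDerivAt (fun y : ℂ => -decayRate c a z k * y) (-decayRate c a z k) (x : ℂ) := by
    simpa using (hasDerivAt_id (x : ℂ)).const_mul (-decayRate c a z k)
  exact (h.cexp.congr_deriv (mul_comm _ _)).comp_ofReal

theorem hasDerivAt_growSol (k : Fin n) (x : ℝ) :
    HasDerivAt (growSol c a z k) (growSolDeriv c a z k x) x := by
  have h : HasDerivAt (fun y : ℂ => decayRate c a z k * y) (decayRate c a z k) (x : ℂ) := by
    simpa using (hasDerivAt_id (x : ℂ)).const_mul (decayRate c a z k)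
  refine ((h.ccosh.add (h.csinh.const_mul (sinhCoeff c a z k))).congr_deriv ?_).comp_ofReal
  rw [growSolDeriv]
  ring

theorem hasDerivAt_growSolDeriv (k : Fin n) (x : ℝ) :
    HasDerivAt (growSolDeriv c a z k) (decayRate c a z k ^ 2 * growSol c a z k x) x := by
  have h : HasDerivAt (fun y : ℂ => decayRate c a z k * y) (decayRate c a z k) (x : ℂ) := by
    simpa using (hasDerivAt_id (x : ℂ)).const_mul (decayRate c a z k)
  refine (((h.csinh.add (h.ccosh.const_mul (sinhCoeff c a z k))).const_mul
    (decayRate c a z k)).congr_deriv ?_).comp_ofReal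
  rw [growSol]
  ring

theorem continuous_decaySol (k : Fin n) : Continuous (decaySol c a z k) :=
  continuous_iff_continuousAt.2 fun x => (hasDerivAt_decaySol k x).continuousAt

theorem continuous_growSol (k : Fin n) : Continuous (growSol c a z k) :=
  continuous_iff_continuousAt.2 fun x => (hasDerivAt_growSol k x).continuousAt

/-- The Wronskian of the two solutions on a branch is constant. -/
theorem decaySol_wronskian (hc : ∀ k, 0 < c k) (hμ : ∀ k, 0 < (decayRate c a z k).re)
    (k : Fin n) (x : ℝ) : (c k : ℂ) * (decaySol c a z k x *
      (decayRate c a z k * growSol c a z k x + growSolDeriv c a z k x)) = -starWronskian c a z := by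
  rw [← mul_one_add_sinhCoeff hc hμ k]
  have e : decaySol c a z k x * Complex.exp (decayRate c a z k * x) = 1 := by
    rw [decaySol, ← Complex.exp_add]
    simp
  rw [← Complex.cosh_add_sinh] at e
  rw [growSol, growSolDeriv]
  linear_combination ((c k : ℂ) * decayRate c a z k * (1 + sinhCoeff c a z k)) * e

/-- A function which is continuous up to `B` and a multiple of a decaying exponential beyond `B` is
square integrable. -/
theorem memLp_of_eq_exp_of_lt {F G : ℝ → ℂ} {B : ℝ} {C ν : ℂ} (hν : ν.re < 0) (hG : Continuous G)
    (h1 : ∀ x ≤ B, F x = G x) (h2 : ∀ x, B < x → F x = C * Complex.exp (ν * x)) :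
    MemLp F 2 (volume.restrict (Ioi (0 : ℝ))) := by
  have m1 : MemLp ((Iic B).indicator G) 2 (volume.restrict (Ioi (0 : ℝ))) := by
    rw [memLp_indicator_iff_restrict measurableSet_Iic, Measure.restrict_restrict measurableSet_Iic,
      inter_comm, Ioi_inter_Iic]
    obtain ⟨M, hM⟩ := (isCompact_Icc (a := (0 : ℝ)) (b := B)).exists_bound_of_continuousOn
      hG.continuousOn
    refine MemLp.of_bound hG.aestronglyMeasurable M ?_
    filter_upwards [ae_restrict_mem measurableSet_Ioc] with x hx
    exact hM x ⟨hx.1.le, hx.2⟩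
  have m2 : MemLp ((Ioi B).indicator fun x : ℝ => C * Complex.exp (ν * x)) 2
      (volume.restrict (Ioi (0 : ℝ))) := by
    refine MemLp.indicator measurableSet_Ioi ?_
    simpa using (memLp_pow_mul_cexp 0 hν).const_mul C
  refine (m1.add m2).ae_eq (ae_of_all _ fun x => ?_)
  by_cases hx : x ≤ B
  · simp [hx, h1 x hx]
  · simp [hx, not_le.1 hx, h2 x (not_le.1 hx)]

/-- For fixed `x`, the rows of the kernel are square integrable, so the kernel integrals converge
absolutely for every `f ∈ H`. -/
theorem memLp_starKernel (hn : 2 ≤ n) (hμ : ∀ k, 0 < (decayRate c a z k).re) (i k : Fin n) (x : ℝ) :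
    MemLp (fun x' => starKernel c a z x x' i k) 2 (volume.restrict (Ioi (0 : ℝ))) := by
  have hν : ∀ k, (-decayRate c a z k).re < 0 := fun k => by simpa using hμ k
  by_cases h : k = i
  · subst h
    exact memLp_of_eq_exp_of_lt (hν k) (continuous_const.mul (continuous_growSol k))
      (fun x' hx' => starKernel_self_of_le hn k hx') (fun x' hx' => starKernel_self_of_lt hn k hx')
  · simp only [starKernel_of_ne hn h]
    refine MemLp.const_mul ?_ _
    unfold decaySol
    simpa using memLp_pow_mul_cexp 0 (hν k)

end Rates

/-! ### The resolvent on compactly supported continuous functions -/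

open Filter Topology

section Solution

variable {n : ℕ} {c a : Fin n → ℝ} {z : ℂ}

/-- For continuous `g` with bounded support, the resolvent applied to `g` on the single branch `N_k`
is given by the kernel: variation of constants yields a classical solution. -/
theorem IsResolvent.apply_single_of_continuous (hn : 2 ≤ n) (hc : ∀ k, 0 < c k)
    (hμ : ∀ k, 0 < (decayRate c a z k).re) {R : StarL2 n →L[ℂ] StarL2 n}
    (hR : IsResolvent (starOp c a) z R) (k : Fin n) {g : ℝ → ℂ} (hg : Continuous g)
    (hgs : HasCompactSupport g) (mg : MemLp g 2 (volume.restrict (Ioi (0 : ℝ)))) (i : Fin n) :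
    ∀ᵐ x ∂(volume.restrict (Ioi (0 : ℝ))), R (PiLp.single 2 k (mg.toLp g)) i x =
      ∫ x' in Ioi (0 : ℝ), starKernel c a z x x' i k * g x' := by
  classical
  set W := starWronskian c a z with hW
  have hW0 : W ≠ 0 := starWronskian_ne_zero hn hc hμ
  set e := decaySol c a z with he
  set F := growSol c a z with hF
  set F' := growSolDeriv c a z with hF'
  set μ := decayRate c a z
  have hν : ∀ k, (-μ k).re < 0 := fun k => by simpa using hμ k
  have hck : ∀ k, (c k : ℂ) ≠ 0 := fun k => Complex.ofReal_ne_zero.2 (hc k).ne'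
  have he1 : ∀ i x, HasDerivAt (e i) (-μ i * e i x) x := fun i x => hasDerivAt_decaySol i x
  have hF1 : ∀ i x, HasDerivAt (F i) (F' i x) x := fun i x => hasDerivAt_growSol i x
  have hF2 : ∀ i x, HasDerivAt (F' i) (μ i ^ 2 * F i x) x := fun i x => hasDerivAt_growSolDeriv i x
  have hec : ∀ i, Continuous (e i) := continuous_decaySol
  have hFc : ∀ i, Continuous (F i) := continuous_growSol
  obtain ⟨B, hB0, hB⟩ : ∃ B : ℝ, 0 < B ∧ ∀ x, B < x → g x = 0 := by
    obtain ⟨r, hr⟩ := hgs.isBounded.subset_closedBall 0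
    refine ⟨max r 1, by positivity, fun x hx => ?_⟩
    by_contra h
    have h1 := hr (subset_tsupport _ h)
    rw [mem_closedBall_zero_iff, Real.norm_eq_abs] at h1
    have := le_abs_self x
    have := le_max_left r 1
    linarith
  have ieg : ∀ h : ℝ → ℂ, Continuous h → IntegrableOn (fun x => h x * g x) (Ioi 0) := fun h hh =>
    ((hh.mul hg).integrable_of_hasCompactSupport hgs.mul_left).integrableOn
  set I := ∫ x' in Ioi (0 : ℝ), e k x' * g x' with hI
  -- Variation of constants: `P` and `Q` are the coefficients of the decaying and of the other
  -- solution. Beyond the support of `g`, `P` is constant and `Q` vanishes, whence the decay of `U`.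
  let P : ℝ → ℂ := fun x => ∫ t in (0 : ℝ)..x, F k t * g t
  let Q : ℝ → ℂ := fun x => I - ∫ t in (0 : ℝ)..x, e k t * g t
  have hP : ∀ x, HasDerivAt P (F k x * g x) x := fun x =>
    (((hFc k).mul hg).integral_hasStrictDerivAt 0 x).hasDerivAt
  have hQ : ∀ x, HasDerivAt Q (-(e k x * g x)) x := fun x =>
    (((hec k).mul hg).integral_hasStrictDerivAt 0 x).hasDerivAt.const_sub I
  have hQi : ∀ x, 0 ≤ x → Q x = ∫ t in Ioi x, e k t * g t := fun x hx => by
    have := intervalIntegral.integral_interval_add_Ioi (ieg _ (hec k))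
      ((ieg _ (hec k)).mono_set (Ioi_subset_Ioi hx))
    rw [← hI] at this
    simp only [Q, ← this, add_sub_cancel_left]
  have hQB : ∀ x, B < x → Q x = 0 := fun x hx => by
    rw [hQi x (hB0.le.trans hx.le)]
    refine setIntegral_eq_zero_of_forall_eq_zero fun t ht => ?_
    rw [hB t (hx.trans ht), mul_zero]
  have hPB : ∀ x, B < x → P x = P B := fun x hx => by
    simp only [P]
    have hi : ∀ p q : ℝ, IntervalIntegrable (fun t => F k t * g t) volume p q := fun p q =>
      ((hFc k).mul hg).intervalIntegrable p q
    rw [← intervalIntegral.integral_add_adjacent_intervals (hi 0 B) (hi B x), add_eq_left,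
      intervalIntegral.integral_of_le hx.le]
    refine setIntegral_eq_zero_of_forall_eq_zero fun t ht => ?_
    rw [hB t ht.1, mul_zero]
  -- `U`, with derivatives `V` and `Z`, is the kernel applied to `g`.
  let U : Fin n → ℝ → ℂ := fun i x =>
    if i = k then W⁻¹ * (e i x * P x + F i x * Q x) else W⁻¹ * I * e i x
  let V : Fin n → ℝ → ℂ := fun i x =>
    if i = k then W⁻¹ * (-μ i * e i x * P x + F' i x * Q x) else W⁻¹ * I * (-μ i * e i x)
  let Z : Fin n → ℝ → ℂ := fun i x => μ i ^ 2 * U i x + if i = k then (c k : ℂ)⁻¹ * g x else 0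
  have hU : ∀ i x, HasDerivAt (U i) (V i x) x := by
    intro i x
    by_cases h : i = k
    · subst h
      simp only [U, V, if_true]
      refine ((((he1 i x).mul (hP x)).add ((hF1 i x).mul (hQ x))).const_mul W⁻¹).congr_deriv ?_
      ring
    · simp only [U, V, h, if_false]
      exact (he1 i x).const_mul (W⁻¹ * I)
  have hV : ∀ i x, HasDerivAt (V i) (Z i x) x := by
    intro i x
    by_cases h : i = k
    · subst h
      simp only [U, V, Z, if_true]
      have hw := decaySol_wronskian hc hμ i x
      refine (((((he1 i x).const_mul (-μ i)).mul (hP x)).add ((hF2 i x).mul (hQ x))).const_mul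
        W⁻¹).congr_deriv ?_
      have hw' : e i x * (μ i * F i x + F' i x) = -W * (c i : ℂ)⁻¹ := by
        rw [eq_mul_inv_iff_mul_eq₀ (hck i), mul_comm]
        exact hw
      linear_combination (-W⁻¹ * g x) * hw' + (g x * (c i : ℂ)⁻¹) * (mul_inv_cancel₀ hW0)
    · simp only [U, V, Z, h, if_false]
      refine (((he1 i x).const_mul (-μ i)).const_mul (W⁻¹ * I)).congr_deriv ?_
      ring
  have hUc : ∀ i, Continuous (U i) := fun i =>
    continuous_iff_continuousAt.2 fun x => (hU i x).continuousAt
  have hZ : ∀ i, Continuous (Z i) := by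
    intro i
    have := hUc i
    by_cases h : i = k
    · simp only [Z, h, if_true]; subst h; fun_prop
    · simp only [Z, h, if_false]; fun_prop
  have me : ∀ i, MemLp (e i) 2 (volume.restrict (Ioi (0 : ℝ))) := fun i => by
    have := memLp_pow_mul_cexp 0 (hν i)
    simp only [pow_zero, one_mul] at this
    exact this
  have mU : ∀ i, MemLp (U i) 2 (volume.restrict (Ioi (0 : ℝ))) := by
    intro i
    by_cases h : i = k
    · refine memLp_of_eq_exp_of_lt (B := B) (C := W⁻¹ * P B) (hν i) (hUc i) (fun _ _ => rfl)
        fun x hx => ?_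
      simp only [U, h, if_true, hQB x hx, hPB x hx]
      subst h
      change _ = W⁻¹ * P B * e i x
      ring
    · simp only [U, h, if_false]
      exact (me i).const_mul _
  have mV : ∀ i, MemLp (V i) 2 (volume.restrict (Ioi (0 : ℝ))) := by
    intro i
    by_cases h : i = k
    · refine memLp_of_eq_exp_of_lt (B := B) (C := W⁻¹ * P B * (-μ i)) (hν i)
        (continuous_iff_continuousAt.2 fun x => (hV i x).continuousAt) (fun _ _ => rfl)
        fun x hx => ?_
      simp only [V, h, if_true, hQB x hx, hPB x hx]
      subst h
      change _ = W⁻¹ * P B * (-μ i) * e i x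
      ring
    · simp only [V, h, if_false]
      exact ((me i).const_mul _).const_mul _
  have mZ : ∀ i, MemLp (Z i) 2 (volume.restrict (Ioi (0 : ℝ))) := by
    intro i
    by_cases h : i = k
    · simp only [Z, h, if_true]
      exact ((mU k).const_mul _).add (mg.const_mul _)
    · simp only [Z, h, if_false, add_zero]
      exact (mU i).const_mul _
  have hP0 : P 0 = 0 := intervalIntegral.integral_same
  have hQ0 : Q 0 = I := by simp only [Q, intervalIntegral.integral_same, sub_zero]
  have e0 : ∀ i, e i 0 = 1 := decaySol_zero
  have F0 : ∀ i, F i 0 = 1 := growSol_zero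
  have hU0 : ∀ i, U i 0 = W⁻¹ * I := by
    intro i
    simp only [U, hP0, hQ0, e0, F0]
    split_ifs <;> ring
  have hV0 : ∑ i, (c i : ℂ) * V i 0 = 0 := by
    have hk : (c k : ℂ) * F' k 0 = -W - c k * μ k := by
      have := decaySol_wronskian hc hμ k 0
      rw [← he, ← hF, ← hF', e0, F0] at this
      linear_combination this
    rw [← Finset.add_sum_erase _ _ (Finset.mem_univ k)]
    have e2 : ∑ i ∈ Finset.univ.erase k, (c i : ℂ) * V i 0 =
        -(W⁻¹ * I) * ∑ i ∈ Finset.univ.erase k, (c i : ℂ) * μ i := by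
      rw [Finset.mul_sum]
      refine Finset.sum_congr rfl fun i hi => ?_
      simp only [V, if_neg (Finset.ne_of_mem_erase hi), e0]
      ring
    have e3 : ∑ i ∈ Finset.univ.erase k, (c i : ℂ) * μ i = -W - c k * μ k := by
      rw [eq_sub_iff_add_eq, add_comm,
        Finset.add_sum_erase _ (fun i => (c i : ℂ) * μ i) (Finset.mem_univ k), hW,
        starWronskian_eq, neg_neg]
    rw [e2, e3]
    simp only [V, if_true, hP0, hQ0]
    linear_combination (W⁻¹ * I) * hk
  have key := hR.apply_eq_toLp hU hV hZ mU mV mZ (fun i j => (hU0 i).trans (hU0 j).symm) hV0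
    (f := PiLp.single 2 k (mg.toLp g)) ?_
  · rw [key]
    filter_upwards [(mU i).coeFn_toLp, ae_restrict_mem measurableSet_Ioi] with x hx hx0
    rw [hx]
    have hx0' : (0 : ℝ) ≤ x := le_of_lt hx0
    by_cases h : i = k
    · subst h
      simp only [U, if_true]
      have hint : IntegrableOn (fun x' => starKernel c a z x x' i i * g x') (Ioi 0) :=
        (memLp_starKernel hn hμ i i x).integrable_mul mg
      have e1 : ∫ x' in Ioc 0 x, starKernel c a z x x' i i * g x' = W⁻¹ * e i x * P x := by
        simp only [P]
        rw [intervalIntegral.integral_of_le hx0', ← integral_const_mul]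
        refine setIntegral_congr_fun measurableSet_Ioc fun t ht => ?_
        simp only [starKernel_self_of_le hn i ht.2]
        ring
      have e2 : ∫ x' in Ioi x, starKernel c a z x x' i i * g x' = W⁻¹ * F i x * Q x := by
        rw [hQi x hx0', ← integral_const_mul]
        refine setIntegral_congr_fun measurableSet_Ioi fun t ht => ?_
        simp only [starKernel_self_of_lt hn i ht]
        ring
      rw [← Ioc_union_Ioi_eq_Ioi hx0', setIntegral_union (Ioc_disjoint_Ioi le_rfl)
        measurableSet_Ioi (hint.mono_set Ioc_subset_Ioi_self)
        (hint.mono_set (Ioi_subset_Ioi hx0')), e1, e2]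
      ring
    · simp only [U, h, if_false]
      rw [hI, mul_right_comm, ← integral_const_mul]
      refine setIntegral_congr_fun measurableSet_Ioi fun t _ => ?_
      simp only [starKernel_of_ne hn (Ne.symm h)]
      ring
  · intro j
    have hs := decayRate_sq (z := z) (a := a) hc j
    by_cases h : j = k
    · subst h
      filter_upwards [mg.coeFn_toLp] with x hx
      rw [PiLp.single_apply, if_pos rfl, hx]
      simp only [Z, if_true]
      linear_combination (-(U j x)) * hs - g x * (mul_inv_cancel₀ (hck j))
    · filter_upwards [Lp.coeFn_zero ℂ 2 (volume.restrict (Ioi (0 : ℝ)))] with x hx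
      rw [PiLp.single_apply, if_neg h, hx]
      simp only [Z, h, if_false, Pi.zero_apply]
      linear_combination (-(U j x)) * hs

end Solution

/-! ### Extension to `L²` -/

theorem HalfL2.exists_continuous_norm_sub_le (f : HalfL2) {ε : ℝ} (hε : 0 < ε) :
    ∃ g : ℝ → ℂ, Continuous g ∧ HasCompactSupport g ∧
      ∃ mg : MemLp g 2 (volume.restrict (Ioi (0 : ℝ))), ‖mg.toLp g - f‖ ≤ ε := by
  have hf : MemLp ((Ioi (0 : ℝ)).indicator f) 2 volume :=
    (memLp_indicator_iff_restrict measurableSet_Ioi).2 (Lp.memLp f)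
  obtain ⟨g, hgs, hle, hg, mg⟩ := hf.exists_hasCompactSupport_eLpNorm_sub_le (by norm_num)
    (ENNReal.ofReal_pos.2 hε).ne'
  have mg' := mg.mono_measure (Measure.restrict_le_self (s := Ioi (0 : ℝ)))
  refine ⟨g, hg, hgs, mg', ?_⟩
  rw [norm_sub_rev, Lp.norm_def]
  refine ENNReal.toReal_le_of_le_ofReal hε.le (le_trans ?_ hle)
  refine le_trans (le_of_eq (eLpNorm_congr_ae ?_))
    (eLpNorm_mono_measure _ (Measure.restrict_le_self (s := Ioi (0 : ℝ))))
  filter_upwards [Lp.coeFn_sub f (mg'.toLp g), mg'.coeFn_toLp, ae_restrict_mem measurableSet_Ioi]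
    with x h1 h2 h3
  rw [h1, Pi.sub_apply, Pi.sub_apply, h2, indicator_of_mem h3]

theorem HalfL2.continuous_integral_mul {h : ℝ → ℂ}
    (hh : MemLp h 2 (volume.restrict (Ioi (0 : ℝ)))) :
    Continuous fun f : HalfL2 => ∫ x in Ioi (0 : ℝ), h x * f x := by
  have e : (fun f : HalfL2 => ∫ x in Ioi (0 : ℝ), h x * f x) =
      fun f : HalfL2 => inner ℂ (hh.star.toLp (star h)) f := by
    funext f
    rw [L2.inner_def]
    refine integral_congr_ae ?_
    filter_upwards [hh.star.coeFn_toLp] with x hx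
    rw [hx]
    simp [mul_comm]
  rw [e]
  exact continuous_const.inner continuous_id

section Kernel

variable {n : ℕ} {c a : Fin n → ℝ} {z : ℂ}

/-- The kernel formula extends from compactly supported continuous functions to `L²` by density:
for fixed `x` the kernel integral is continuous in `f`, and an `L²`-convergent sequence has an almost
everywhere convergent subsequence. -/
theorem IsResolvent.apply_single (hn : 2 ≤ n) (hc : ∀ k, 0 < c k)
    (hμ : ∀ k, 0 < (decayRate c a z k).re) {R : StarL2 n →L[ℂ] StarL2 n}
    (hR : IsResolvent (starOp c a) z R) (k : Fin n) (f : HalfL2) (i : Fin n) :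
    ∀ᵐ x ∂(volume.restrict (Ioi (0 : ℝ))), R (PiLp.single 2 k f) i x =
      ∫ x' in Ioi (0 : ℝ), starKernel c a z x x' i k * f x' := by
  choose g hg hgs mg hle using fun m : ℕ =>
    f.exists_continuous_norm_sub_le (ε := 1 / ((m : ℝ) + 1)) (by positivity)
  set F : ℕ → HalfL2 := fun m => (mg m).toLp (g m) with hF
  have hFf : Tendsto F atTop (𝓝 f) := by
    rw [tendsto_iff_norm_sub_tendsto_zero]
    exact squeeze_zero (fun _ => norm_nonneg _) hle tendsto_one_div_add_atTop_nhds_zero_nat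
  have hsingle : Continuous fun h : HalfL2 => R (PiLp.single 2 k h) i := by
    have h1 : Continuous fun h : HalfL2 => (PiLp.single 2 k h : StarL2 n) := by
      refine (PiLp.continuous_toLp 2 _).comp (continuous_pi fun j => ?_)
      by_cases hj : j = k
      · subst hj; simpa using continuous_id'
      · simpa [hj] using continuous_const
    exact (PiLp.continuous_apply 2 _ i).comp (R.continuous.comp h1)
  have hlim : Tendsto (fun m => R (PiLp.single 2 k (F m)) i) atTop
      (𝓝 (R (PiLp.single 2 k f) i)) := (hsingle.tendsto f).comp hFf
  obtain ⟨ns, hns, hae⟩ := (tendstoInMeasure_of_tendsto_Lp hlim).exists_seq_tendsto_ae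
  have hcont : ∀ᵐ x ∂(volume.restrict (Ioi (0 : ℝ))), ∀ m, R (PiLp.single 2 k (F m)) i x =
      ∫ x' in Ioi (0 : ℝ), starKernel c a z x x' i k * g m x' :=
    ae_all_iff.2 fun m => hR.apply_single_of_continuous hn hc hμ k (hg m) (hgs m) (mg m) i
  filter_upwards [hae, hcont] with x h1 h2
  refine tendsto_nhds_unique h1 ?_
  have h3 := ((HalfL2.continuous_integral_mul (memLp_starKernel hn hμ i k x)).tendsto f).comp
    (hFf.comp hns.tendsto_atTop)
  refine h3.congr fun m => ?_
  rw [h2 (ns m)]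
  refine integral_congr_ae ?_
  filter_upwards [(mg (ns m)).coeFn_toLp] with x' hx'
  simp only [Function.comp_apply, hF, hx']

theorem IsResolvent.isIntegralKernel_starKernel (hn : 2 ≤ n) (hc : ∀ k, 0 < c k)
    (hμ : ∀ k, 0 < (decayRate c a z k).re) {R : StarL2 n →L[ℂ] StarL2 n}
    (hR : IsResolvent (starOp c a) z R) : IsIntegralKernel R (starKernel c a z) := by
  intro f i
  have hf : R f i = ∑ k, R (PiLp.single 2 k (f k)) i := by
    have h1 : f = ∑ k, PiLp.single 2 k (f k) := by
      ext1 j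
      simp
    conv_lhs => rw [h1, map_sum]
    simp
  have hall : ∀ᵐ x ∂(volume.restrict (Ioi (0 : ℝ))), ∀ k, R (PiLp.single 2 k (f k)) i x =
      ∫ x' in Ioi (0 : ℝ), starKernel c a z x x' i k * f k x' :=
    ae_all_iff.2 fun k => hR.apply_single hn hc hμ k (f k) i
  filter_upwards [hall, Lp.coeFn_finsetSum Finset.univ fun k => R (PiLp.single 2 k (f k)) i]
    with x h1 h2
  refine ⟨fun j => (memLp_starKernel hn hμ i j x).integrable_mul (Lp.memLp (f j)), ?_⟩
  rw [hf, h2, Finset.sum_apply]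
  exact Finset.sum_congr rfl fun k _ => h1 k

end Kernel

/-! ### Weidmann's form is impossible -/

/-- A function which is continuous up to `0` vanishes there if its averages over the intervals
`(0, 1 / (m + 1)]` do. -/
theorem eq_zero_of_integral_Ioc_eq_zero {D : ℝ → ℂ} (hD : ContinuousOn D (Ici 0))
    (h : ∀ᶠ m : ℕ in atTop, ∫ x in Ioc (0 : ℝ) (1 / ((m : ℝ) + 1)), D x = 0) : D 0 = 0 := by
  have hc : Continuous fun x : ℝ => D (max x 0) :=
    hD.comp_continuous (by fun_prop) fun x => le_max_right x 0
  have hd : HasDerivAt (fun u => ∫ t in (0 : ℝ)..u, D (max t 0)) (D 0) 0 := by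
    simpa using (hc.integral_hasStrictDerivAt 0 0).hasDerivAt
  have ht : Tendsto (fun m : ℕ => 1 / ((m : ℝ) + 1)) atTop (𝓝[≠] 0) :=
    tendsto_nhdsWithin_iff.2 ⟨tendsto_one_div_add_atTop_nhds_zero_nat,
      Eventually.of_forall fun m => by
        have : (0 : ℝ) < 1 / ((m : ℝ) + 1) := by positivity
        exact this.ne'⟩
  refine tendsto_nhds_unique ((hasDerivAt_iff_tendsto_slope.1 hd).comp ht)
    (tendsto_const_nhds.congr' ?_)
  filter_upwards [h] with m hm
  have e : ∫ t in (0 : ℝ)..(1 / ((m : ℝ) + 1)), D (max t 0) = 0 := by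
    rw [intervalIntegral.integral_of_le (by positivity), ← hm]
    refine setIntegral_congr_fun measurableSet_Ioc fun t ht => ?_
    simp only [max_eq_left ht.1.le]
  rw [Function.comp_apply, slope_def_module, e]
  simp

theorem integral_mul_indicatorConstLp (h : ℝ → ℂ) {b : ℝ}
    (hs : volume.restrict (Ioi (0 : ℝ)) (Ioc 0 b) ≠ ⊤) :
    ∫ x in Ioi (0 : ℝ), h x * (indicatorConstLp 2 measurableSet_Ioc hs (1 : ℂ) : HalfL2) x =
      ∫ x in Ioc (0 : ℝ) b, h x := by
  have e : volume.restrict (Ioc (0 : ℝ) b) =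
      (volume.restrict (Ioi (0 : ℝ))).restrict (Ioc 0 b) := by
    rw [Measure.restrict_restrict measurableSet_Ioc,
      inter_eq_self_of_subset_left Ioc_subset_Ioi_self]
  rw [e, ← integral_indicator measurableSet_Ioc]
  refine integral_congr_ae ?_
  filter_upwards [indicatorConstLp_coeFn (p := 2) (hs := measurableSet_Ioc) (hμs := hs)
    (c := (1 : ℂ))] with x hx
  rw [hx]
  by_cases hm : x ∈ Ioc 0 b
  · rw [indicator_of_mem hm, indicator_of_mem hm, mul_one]
  · rw [indicator_of_notMem hm, indicator_of_notMem hm, mul_zero]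

theorem TransmissionT1.sum {n : ℕ} {c : Fin n → ℝ} {ι : Type*} (s : Finset ι)
    {U : ι → Fin n → ℝ → ℂ} (hU : ∀ l, TransmissionT1 c (U l)) :
    TransmissionT1 c fun k x => ∑ l ∈ s, U l k x := by
  classical
  induction s using Finset.induction_on with
  | empty => exact ⟨fun k => by simpa using contDiffOn_const, by simp⟩
  | insert l s hl ih =>
    simp only [Finset.sum_insert hl]
    exact (hU l).add ih

/-- Two kernels of the same operator have the same averages in the second variable over the
intervals `(0, 1 / (m + 1)]`. -/
theorem IsIntegralKernel.ae_integral_Ioc_eq {n : ℕ} {R : StarL2 n →L[ℂ] StarL2 n}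
    {κ κ' : ℝ → ℝ → Matrix (Fin n) (Fin n) ℂ} (h : IsIntegralKernel R κ)
    (h' : IsIntegralKernel R κ') (i k : Fin n) :
    ∀ᵐ x ∂(volume.restrict (Ioi (0 : ℝ))), ∀ m : ℕ,
      ∫ x' in Ioc (0 : ℝ) (1 / ((m : ℝ) + 1)), κ x x' i k =
        ∫ x' in Ioc (0 : ℝ) (1 / ((m : ℝ) + 1)), κ' x x' i k := by
  rw [ae_all_iff]
  intro m
  have hs : volume.restrict (Ioi (0 : ℝ)) (Ioc 0 (1 / ((m : ℝ) + 1))) ≠ ⊤ :=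
    ((Measure.restrict_apply_le _ _).trans_lt measure_Ioc_lt_top).ne
  set f : HalfL2 := indicatorConstLp 2 measurableSet_Ioc hs (1 : ℂ) with hf
  have hsum : ∀ κ : ℝ → ℝ → Matrix (Fin n) (Fin n) ℂ, ∀ x,
      ∑ j, ∫ x' in Ioi (0 : ℝ), κ x x' i j * (PiLp.single 2 k f : StarL2 n) j x' =
        ∫ x' in Ioc (0 : ℝ) (1 / ((m : ℝ) + 1)), κ x x' i k := by
    intro κ x
    rw [Finset.sum_eq_single k]
    · rw [PiLp.single_apply, if_pos rfl, hf]
      exact integral_mul_indicatorConstLp _ hs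
    · intro j _ hj
      rw [PiLp.single_apply, if_neg hj]
      refine integral_eq_zero_of_ae ?_
      filter_upwards [Lp.coeFn_zero ℂ 2 (volume.restrict (Ioi (0 : ℝ)))] with x' hx'
      rw [hx']
      simp
    · simp
  filter_upwards [h (PiLp.single 2 k f) i, h' (PiLp.single 2 k f) i] with x h1 h2
  rw [← hsum κ x, ← hsum κ' x, ← h1.2, ← h2.2]

section Weidmann

variable {n : ℕ} {c a : Fin n → ℝ} {z : ℂ}

/-- The boundary values at `x' = 0` of a kernel in Weidmann's form: they are a combination of the
generalized eigenfunctions in `x`, and must agree with the decaying solutions on all branches. -/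
theorem HasWeidmannForm.boundary_value (hn : 2 ≤ n) {R : StarL2 n →L[ℂ] StarL2 n}
    {κ : ℝ → ℝ → Matrix (Fin n) (Fin n) ℂ} (hK : IsIntegralKernel R (starKernel c a z))
    (hκ : IsIntegralKernel R κ) {p : ℕ} {α β : Matrix (Fin p) (Fin p) ℂ}
    {w : Fin p → Fin n → ℝ → ℂ} (hw : ∀ q, TransmissionT0 (w q)) (hform : HasWeidmannForm κ α β w)
    (i k : Fin n) : EqOn (fun x => ∑ l, (∑ q, α l q * w q k 0) * w l i x)
      (fun x => (starWronskian c a z)⁻¹ * decaySol c a z i x) (Ici 0) := by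
  have hv : ContinuousOn (fun x => ∑ l, (∑ q, α l q * w q k 0) * w l i x) (Ici 0) :=
    continuousOn_finsetSum _ fun l _ => continuousOn_const.mul ((hw l).1 i)
  have he : Continuous fun x => (starWronskian c a z)⁻¹ * decaySol c a z i x :=
    continuous_const.mul (continuous_decaySol i)
  refine EqOn.of_subset_closure (s := Ioi 0) ?_ hv he.continuousOn Ioi_subset_Ici_self
    (by rw [closure_Ioi])
  refine Measure.eqOn_open_of_ae_eq (μ := volume) ?_ isOpen_Ioi (hv.mono Ioi_subset_Ici_self)
    he.continuousOn
  filter_upwards [hκ.ae_integral_Ioc_eq hK i k, ae_restrict_mem measurableSet_Ioi] with x hx hx0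
  have hx0' : (0 : ℝ) < x := hx0
  let M : ℝ → ℂ := fun x' => ∑ l, (∑ q, α l q * w q k x') * w l i x
  let N : ℝ → ℂ := fun x' => (starWronskian c a z)⁻¹ * decaySol c a z i x *
    (if k = i then growSol c a z k x' else decaySol c a z k x')
  have hM : ContinuousOn M (Ici 0) := continuousOn_finsetSum _ fun l _ =>
    (continuousOn_finsetSum _ fun q _ => continuousOn_const.mul ((hw q).1 k)).mul continuousOn_const
  have hN : Continuous N := by
    refine continuous_const.mul ?_
    split_ifs
    exacts [continuous_growSol k, continuous_decaySol k]
  have h0 : M 0 - N 0 = 0 := by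
    refine eq_zero_of_integral_Ioc_eq_zero (D := fun x' => M x' - N x')
      (hM.sub hN.continuousOn) ?_
    -- For `1 / (m + 1) ≤ x` the interval of averaging lies in the region `x' ≤ x`, where both
    -- kernels are given by explicit functions that are continuous up to `x' = 0`.
    filter_upwards [(tendsto_one_div_add_atTop_nhds_zero_nat (𝕜 := ℝ)).eventually_le_const hx0']
      with m hm
    have iM : IntegrableOn M (Ioc 0 (1 / ((m : ℝ) + 1))) :=
      ((hM.mono Icc_subset_Ici_self).integrableOn_Icc).mono_set Ioc_subset_Icc_self
    have iN : IntegrableOn N (Ioc 0 (1 / ((m : ℝ) + 1))) :=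
      (hN.continuousOn.integrableOn_Icc).mono_set Ioc_subset_Icc_self
    rw [integral_sub iM iN, sub_eq_zero]
    have eM : ∫ x' in Ioc (0 : ℝ) (1 / ((m : ℝ) + 1)), κ x x' i k =
        ∫ x' in Ioc (0 : ℝ) (1 / ((m : ℝ) + 1)), M x' := by
      refine setIntegral_congr_fun measurableSet_Ioc fun t ht => ?_
      simp only [hform x t hx0' ht.1, if_pos (ht.2.trans hm), M, Matrix.sum_apply,
        Matrix.vecMulVec_apply, Finset.sum_apply, Pi.smul_apply, smul_eq_mul, Finset.sum_mul]
      rw [Finset.sum_comm]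
      refine Finset.sum_congr rfl fun l _ => Finset.sum_congr rfl fun q _ => ?_
      ring
    have eN : ∫ x' in Ioc (0 : ℝ) (1 / ((m : ℝ) + 1)), starKernel c a z x x' i k =
        ∫ x' in Ioc (0 : ℝ) (1 / ((m : ℝ) + 1)), N x' := by
      refine setIntegral_congr_fun measurableSet_Ioc fun t ht => ?_
      by_cases h : k = i
      · subst h
        simp only [starKernel_self_of_le hn k (ht.2.trans hm), N, if_true]
      · simp only [starKernel_of_ne hn h, N, h, if_false]
    rw [← eM, ← eN]
    exact hx m
  have hN0 : N 0 = (starWronskian c a z)⁻¹ * decaySol c a z i x := by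
    simp [N]
  rw [hN0, sub_eq_zero] at h0
  exact h0

/-- For fixed `k`, the function `x ↦ κ(x, 0)_{i k}`, `i = 1, …, n`, would be a combination of
generalized eigenfunctions, hence satisfy the Kirchhoff condition. But it equals
`W⁻¹ e^{-μ_i x}`, for which the Kirchhoff sum is `-W⁻¹ ∑ c_i μ_i = 1`. -/
theorem not_hasWeidmannForm (hn : 2 ≤ n) (hW : starWronskian c a z ≠ 0)
    {R : StarL2 n →L[ℂ] StarL2 n} {κ : ℝ → ℝ → Matrix (Fin n) (Fin n) ℂ}
    (hK : IsIntegralKernel R (starKernel c a z)) (hκ : IsIntegralKernel R κ) {p : ℕ}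
    {α β : Matrix (Fin p) (Fin p) ℂ} {w : Fin p → Fin n → ℝ → ℂ}
    (hw : ∀ q, IsGenEigenfunction c a z (w q)) : ¬ HasWeidmannForm κ α β w := by
  intro hform
  have hT := (TransmissionT1.sum Finset.univ fun l : Fin p =>
    (hw l).2.2.1.smul (∑ q, α l q * w q ⟨0, by omega⟩ 0)).2
  have hd : ∀ i : Fin n, derivWithin
      (fun x => ∑ l, (∑ q, α l q * w q ⟨0, by omega⟩ 0) * w l i x) (Ici 0) 0 =
      (starWronskian c a z)⁻¹ * -decayRate c a z i := by
    intro i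
    have heq := hform.boundary_value hn hK hκ (fun q => (hw q).2.1) i ⟨0, by omega⟩
    rw [derivWithin_congr heq (heq self_mem_Ici)]
    have h1 := ((hasDerivAt_decaySol (c := c) (a := a) (z := z) i 0).const_mul
      (starWronskian c a z)⁻¹).hasDerivWithinAt (s := Ici 0)
    rw [h1.derivWithin (uniqueDiffOn_Ici 0 0 self_mem_Ici), decaySol_zero, mul_one]
  simp only [hd] at hT
  have h1 : ∑ i, (c i : ℂ) * ((starWronskian c a z)⁻¹ * -decayRate c a z i) =
      (starWronskian c a z)⁻¹ * starWronskian c a z := by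
    rw [starWronskian_eq (c := c) (a := a) (z := z), ← Finset.sum_neg_distrib, Finset.mul_sum]
    exact Finset.sum_congr rfl fun i _ => by ring
  rw [h1, inv_mul_cancel₀ hW] at hT
  exact one_ne_zero hT

end Weidmann

theorem theorem8p1 (n : ℕ) (hn : 2 ≤ n) (c a : Fin n → ℝ) (hc : ∀ k, 0 < c k)
    (ha : ∀ k, 0 ≤ a k) (hmono : Monotone a) (z : ℂ)
    (hz : z ∈ unboundedResolventSet (starOp c a)) :
    IsResolventKernel (starOp c a) z (starKernel c a z) ∧
      ∀ κ : ℝ → ℝ → Matrix (Fin n) (Fin n) ℂ, IsResolventKernel (starOp c a) z κ →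
        ¬ ∃ (p : ℕ) (α β : Matrix (Fin p) (Fin p) ℂ) (w : Fin p → Fin n → ℝ → ℂ),
          (∀ q, IsGenEigenfunction c a z (w q)) ∧ HasWeidmannForm κ α β w := by
  have hμ : ∀ k, 0 < (decayRate c a z k).re := fun k =>
    decayRate_re_pos hc k (not_mem_half_line_of_mem_resolventSet hc hz k)
  obtain ⟨R, hR⟩ := hz
  have hK := hR.isIntegralKernel_starKernel hn hc hμ
  refine ⟨⟨R, hR, hK⟩, ?_⟩
  rintro κ ⟨R', hR', hκ⟩ ⟨p, α, β, w, hw, hform⟩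
  rw [hR'.unique hR] at hκ
  exact not_hasWeidmannForm hn (starWronskian_ne_zero hn hc hμ) hK hκ hw hform
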